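/- Let $X$ be a smooth projective toric variety over an algebraically closed field $k$, let $S$ be its Cox ring, graded by $\operatorname{Pic}(X)$, and let $B\subseteq S$ be its irrelevant ideal. For a $\operatorname{Pic}(X)$-graded $S$-module $P$, let $\widetilde P$ (also written $P^\sim$) denote the associated sheaf of $\mathcal O_X$-modules. A virtual resolution of a finitely generated $\operatorname{Pic}(X)$-graded $S$-module $M$ is a complex $F_\bullet=[F_0\leftarrow F_1\leftarrow F_2\leftarrow\cdots]$ of finitely generated graded free $S$-modules, with differentials homogeneous of degree $0$, for which there is a morphism of $\mathcal O_X$-modules $\widetilde F_0\to\widetilde M$ making the sequence of sheaves $0\leftarrow\widetilde M\leftarrow\widetilde F_0\leftarrow\widetilde F_1\leftarrow\widetilde F_2\leftarrow\cdots$ exact. It has length (at most) $\ell$ if $F_i=0$ for all $i>\ell$. Let $M$ be a finitely generated $\operatorname{Pic}(X)$-graded $S$-module. 1. If $F_\bullet$ is any virtual resolution of $M$, then for every finitely generated $\operatorname{Pic}(X)$-graded $S$-module $N$ and every $i\ge 0$ there is an isomorphism of sheaves of $\mathcal O_X$-modules $$\operatorname{Ext}^i_S(M,N)^\sim\;\cong\;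 H^i\bigl(\operatorname{Hom}_S(F_\bullet,N)\bigr)^\sim ,$$ where $\operatorname{Ext}^i_S(M,N)$ and $H^i(\operatorname{Hom}_S(F_\bullet,N))$ carry their natural $\operatorname{Pic}(X)$-gradings. 2. Consequently, if $M$ has a virtual resolution of length $\ell$, then $\operatorname{Ext}^i_S(M,N)^\sim=0$ for every finitely generated $\operatorname{Pic}(X)$-graded $S$-module $N$ and all $i>\ell$. -/

import Mathlib

open CategoryTheory TopologicalSpace Opposite

universe u


noncomputable section

/-! ### Graded modules over a graded ring -/

section GradedModules

variable {A : Type} [AddCommGroup A] [DecidableEq A] {k : Type u} {S : Type u} [CommRing k]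
  [CommRing S] [Algebra k S]

/-- An `A`-graded module over the `A`-graded ring `S = ⨁ 𝒜 a`: an `S`-module that is the internal
direct sum of the additive subgroups `deg a`, with `𝒜 a • deg b ⊆ deg (a + b)`. -/
structure GrMod (𝒜 : A → Submodule k S) where
  carrier : Type u
  [addCommGroup : AddCommGroup carrier]
  [module : Module S carrier]
  deg : A → AddSubgroup carrier
  isInternal : DirectSum.IsInternal deg
  smul_mem : ∀ {a b : A} {s : S} {m : carrier}, s ∈ 𝒜 a → m ∈ deg b → s • m ∈ deg (a + b)

attribute [instance] GrMod.addCommGroup GrMod.module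

/-- Criterion for an internal direct sum decomposition. -/
theorem isInternal_of_sum {M : Type u} [AddCommGroup M] (deg : A → AddSubgroup M)
    (h1 : ∀ m : M, ∃ (s : Finset A) (f : A → M), (∀ a, f a ∈ deg a) ∧ ∑ a ∈ s, f a = m)
    (h2 : ∀ (s : Finset A) (f : A → M), (∀ a, f a ∈ deg a) → ∑ a ∈ s, f a = 0 →
      ∀ a ∈ s, f a = 0) : DirectSum.IsInternal deg := by
  classical
  constructor
  · rw [injective_iff_map_eq_zero]
    intro x hx
    rw [DirectSum.coeAddMonoidHom_eq_dfinsuppSum, DFinsupp.sum] at hx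
    have := h2 x.support (fun a => (x a : M)) (fun a => (x a).2) hx
    ext a
    by_cases ha : a ∈ x.support
    · simpa using this a ha
    · simpa using ha
  · intro m
    obtain ⟨s, f, hf, rfl⟩ := h1 m
    refine ⟨∑ a ∈ s, DirectSum.of (fun a => deg a) a ⟨f a, hf a⟩, ?_⟩
    simp [map_sum]

namespace GrMod

variable {𝒜 : A → Submodule k S}

/-- The projection of a graded module onto its component of degree `a`. -/
def proj (M : GrMod 𝒜) (a : A) : M.carrier →+ M.carrier :=
  letI := M.isInternal.chooseDecomposition
  AddMonoidHom.mk' (fun m => (DirectSum.decompose M.deg m a : M.carrier)) (by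
    intro x y
    simp [DirectSum.decompose_add])

theorem proj_mem (M : GrMod 𝒜) (a : A) (m : M.carrier) : M.proj a m ∈ M.deg a := by
  simp [proj]

theorem proj_same (M : GrMod 𝒜) {a : A} {m : M.carrier} (h : m ∈ M.deg a) :
    M.proj a m = m := by
  let := M.isInternal.chooseDecomposition
  exact DirectSum.decompose_of_mem_same M.deg h

theorem proj_ne (M : GrMod 𝒜) {a b : A} {m : M.carrier} (h : m ∈ M.deg a) (hab : a ≠ b) :
    M.proj b m = 0 := by
  let := M.isInternal.chooseDecomposition
  exact DirectSum.decompose_of_mem_ne M.deg h hab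

theorem exists_sum_proj (M : GrMod 𝒜) (m : M.carrier) :
    ∃ s : Finset A, ∀ t : Finset A, s ⊆ t → ∑ a ∈ t, M.proj a m = m := by
  classical
  let := M.isInternal.chooseDecomposition
  refine ⟨(DirectSum.decompose M.deg m).support, fun t ht => ?_⟩
  conv_rhs => rw [← DirectSum.sum_support_decompose M.deg m]
  symm
  refine Finset.sum_subset ht fun a _ ha => ?_
  simpa using ha

theorem proj_sum (M : GrMod 𝒜) {s : Finset A} {f : A → M.carrier} (hf : ∀ a, f a ∈ M.deg a)
    {a : A} (ha : a ∈ s) : M.proj a (∑ b ∈ s, f b) = f a := by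
  rw [map_sum, Finset.sum_eq_single_of_mem a ha, M.proj_same (hf a)]
  intro b _ hb
  exact M.proj_ne (hf b) hb

variable [GradedAlgebra 𝒜]

theorem exists_sum_decompose (r : S) :
    ∃ s : Finset A, ∀ t : Finset A, s ⊆ t → ∑ a ∈ t, (DirectSum.decompose 𝒜 r a : S) = r := by
  classical
  refine ⟨(DirectSum.decompose 𝒜 r).support, fun t ht => ?_⟩
  conv_rhs => rw [← DirectSum.sum_support_decompose 𝒜 r]
  symm
  refine Finset.sum_subset ht fun a _ ha => ?_
  simpa using ha

theorem proj_smul (M : GrMod 𝒜) (r : S) {m : M.carrier} {b : A} (hm : m ∈ M.deg b) (c : A) :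
    M.proj c (r • m) = (DirectSum.decompose 𝒜 r (c - b) : S) • m := by
  obtain ⟨s, hs⟩ := exists_sum_decompose (𝒜 := 𝒜) r
  have h := hs (insert (c - b) s) (Finset.subset_insert _ _)
  conv_lhs => rw [← h, Finset.sum_smul, map_sum]
  rw [Finset.sum_eq_single_of_mem (c - b) (Finset.mem_insert_self _ _)]
  · apply M.proj_same
    have := M.smul_mem (SetLike.coe_mem (DirectSum.decompose 𝒜 r (c - b))) hm
    rwa [sub_add_cancel] at this
  · intro e _ he
    refine M.proj_ne (M.smul_mem (SetLike.coe_mem (DirectSum.decompose 𝒜 r e)) hm) ?_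
    intro h
    exact he (by rw [← h]; abel)

/-- An `S`-submodule of a graded module is homogeneous if it contains the homogeneous components
of its elements. -/
def IsHomog (M : GrMod 𝒜) (Z : Submodule S M.carrier) : Prop :=
  ∀ z ∈ Z, ∀ a, M.proj a z ∈ Z

/-- The graded module `Z / (Z ∩ Y)` for homogeneous submodules `Y, Z` of a graded module. Its
component of degree `a` consists of the classes of the elements of `Z` of degree `a`. -/
def subquotient (M : GrMod 𝒜) (Z Y : Submodule S M.carrier) (hZ : M.IsHomog Z)
    (hY : M.IsHomog Y) : GrMod 𝒜 where
  carrier := Z ⧸ Y.submoduleOf Z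
  deg a := ((M.deg a).comap Z.subtype.toAddMonoidHom).map
    (Y.submoduleOf Z).mkQ.toAddMonoidHom
  isInternal := by
    refine isInternal_of_sum _ ?_ ?_
    · intro q
      obtain ⟨z, rfl⟩ := Submodule.Quotient.mk_surjective _ q
      obtain ⟨s, hs⟩ := M.exists_sum_proj z.1
      refine ⟨s, fun a => (Y.submoduleOf Z).mkQ ⟨M.proj a z.1, hZ _ z.2 a⟩, ?_, ?_⟩
      · intro a
        exact ⟨⟨M.proj a z.1, hZ _ z.2 a⟩, M.proj_mem a z.1, rfl⟩
      · rw [← map_sum, Submodule.mkQ_apply]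
        congr 1
        ext
        simpa using hs s subset_rfl
    · intro s f hf h a ha
      choose g hg1 hg2 using hf
      have h3 : ∑ a ∈ s, g a ∈ Y.submoduleOf Z := by
        rw [← Submodule.ker_mkQ (Y.submoduleOf Z), LinearMap.mem_ker, map_sum, ← h]
        exact Finset.sum_congr rfl fun b _ => hg2 b
      have h4 : ∑ a ∈ s, (g a : M.carrier) ∈ Y := by
        simpa [Submodule.submoduleOf] using h3
      have h5 := hY _ h4 a
      rw [M.proj_sum (f := fun a => (g a : M.carrier)) hg1 ha] at h5
      rw [← hg2 a]
      exact (Submodule.Quotient.mk_eq_zero _).2 h5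
  smul_mem := by
    rintro a b s _ hs ⟨z, hz, rfl⟩
    exact ⟨s • z, M.smul_mem hs hz, rfl⟩

/-- A homogeneous submodule of a graded module, as a graded module. -/
def ofSubmodule (M : GrMod 𝒜) (Z : Submodule S M.carrier) (hZ : M.IsHomog Z) : GrMod 𝒜 where
  carrier := Z
  deg a := (M.deg a).comap Z.subtype.toAddMonoidHom
  isInternal := by
    refine isInternal_of_sum _ ?_ ?_
    · intro z
      obtain ⟨s, hs⟩ := M.exists_sum_proj z.1
      refine ⟨s, fun a => ⟨M.proj a z.1, hZ _ z.2 a⟩, fun a => M.proj_mem a z.1, ?_⟩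
      ext
      simpa using hs s subset_rfl
    · intro s f hf h a ha
      have h4 : ∑ a ∈ s, (f a : M.carrier) = 0 := by
        simpa using congrArg Subtype.val h
      have h5 := M.proj_sum (f := fun a => (f a : M.carrier)) hf ha
      rw [h4, map_zero] at h5
      ext
      exact h5.symm
  smul_mem := fun hs hz => M.smul_mem hs hz

/-- A homomorphism of graded modules: an `S`-linear map that preserves degrees. -/
structure Hom (M N : GrMod 𝒜) where
  toLin : M.carrier →ₗ[S] N.carrier
  map_deg : ∀ {a : A} {m : M.carrier}, m ∈ M.deg a → toLin m ∈ N.deg a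

/-- Composition of homomorphisms of graded modules. -/
def Hom.comp {M N P : GrMod 𝒜} (g : N.Hom P) (f : M.Hom N) : M.Hom P where
  toLin := g.toLin ∘ₗ f.toLin
  map_deg := fun h => g.map_deg (f.map_deg h)

theorem Hom.proj_comm {M N : GrMod 𝒜} (f : M.Hom N) (a : A) (m : M.carrier) :
    N.proj a (f.toLin m) = f.toLin (M.proj a m) := by
  obtain ⟨s, hs⟩ := M.exists_sum_proj m
  have h := hs (insert a s) (Finset.subset_insert _ _)
  conv_lhs => rw [← h, map_sum]
  exact N.proj_sum (f := fun b => f.toLin (M.proj b m))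
    (fun b => f.map_deg (M.proj_mem b m)) (Finset.mem_insert_self _ _)

theorem Hom.isHomog_ker {M N : GrMod 𝒜} (f : M.Hom N) : M.IsHomog (LinearMap.ker f.toLin) := by
  intro z hz a
  rw [LinearMap.mem_ker] at hz ⊢
  rw [← f.proj_comm, hz, map_zero]

/-- A graded module is (finitely generated and) graded free if it has a finite basis of
homogeneous elements, i.e. if it is a finite direct sum of twists `S(-d j)`. -/
def IsGrFree (F : GrMod 𝒜) : Prop :=
  ∃ (n : ℕ) (b : Module.Basis (Fin n) S F.carrier) (d : Fin n → A), ∀ j, b j ∈ F.deg (d j)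

/-- The `S`-module `Hom_S(F, N)` of all `S`-linear maps, graded by the degree of a map: the
component of degree `a` consists of the `φ` with `φ (F_c) ⊆ N_{a + c}` for all `c`. -/
def homGr (F N : GrMod 𝒜) (hF : F.IsGrFree) : GrMod 𝒜 where
  carrier := F.carrier →ₗ[S] N.carrier
  deg a :=
    { carrier := {φ | ∀ (c : A) (x : F.carrier), x ∈ F.deg c → φ x ∈ N.deg (a + c)}
      add_mem' := fun hf hg c x hx => add_mem (hf c x hx) (hg c x hx)
      zero_mem' := fun _ _ _ => zero_mem _
      neg_mem' := fun hf c x hx => neg_mem (hf c x hx) }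
  isInternal := by
    classical
    obtain ⟨n, b, d, hb⟩ := hF
    refine isInternal_of_sum _ ?_ ?_
    · intro φ
      choose s hs using fun j => N.exists_sum_proj (φ (b j))
      let t : Finset A := Finset.univ.biUnion fun j => (s j).image fun a => a - d j
      refine ⟨t, fun a => b.constr S fun j => N.proj (a + d j) (φ (b j)), ?_, ?_⟩
      · intro a c x hx
        have hx' : x = ∑ j, (DirectSum.decompose 𝒜 (b.repr x j) (c - d j) : S) • b j := by
          conv_lhs => rw [← F.proj_same hx, ← b.sum_repr x, map_sum]
          exact Finset.sum_congr rfl fun j _ => F.proj_smul _ (hb j) c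
        rw [hx', map_sum]
        refine sum_mem fun j _ => ?_
        rw [map_smul, Module.Basis.constr_basis]
        have := N.smul_mem (SetLike.coe_mem (DirectSum.decompose 𝒜 (b.repr x j) (c - d j)))
          (N.proj_mem (a + d j) (φ (b j)))
        rwa [show c - d j + (a + d j) = a + c by abel] at this
      · refine b.ext fun j => ?_
        rw [LinearMap.sum_apply]
        simp only [Module.Basis.constr_basis]
        have h : s j ⊆ t.image fun a => a + d j := by
          intro e he
          refine Finset.mem_image.2 ⟨e - d j, Finset.mem_biUnion.2 ⟨j, Finset.mem_univ _, ?_⟩, by abel⟩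
          exact Finset.mem_image_of_mem _ he
        have h' := hs j _ h
        rwa [Finset.sum_image (fun x _ y _ hxy => add_right_cancel hxy)] at h'
    · intro s f hf h a ha
      refine b.ext fun j => ?_
      have h1 : ∑ e ∈ s.image (fun a => a + d j), f (e - d j) (b j) = 0 := by
        rw [Finset.sum_image (fun x _ y _ hxy => add_right_cancel hxy)]
        simpa using LinearMap.congr_fun h (b j)
      have h2 := N.proj_sum (s := s.image fun a => a + d j) (f := fun e => f (e - d j) (b j))
        (fun e => by simpa using hf (e - d j) (d j) (b j) (hb j))
        (Finset.mem_image_of_mem (fun a => a + d j) ha)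
      rw [h1, map_zero] at h2
      simpa using h2.symm
  smul_mem := by
    intro a c s φ hs hφ e x hx
    have := N.smul_mem hs (hφ e x hx)
    rwa [← add_assoc] at this

/-- Precomposition with a homomorphism of graded modules, `Hom_S(G, N) → Hom_S(F, N)`. -/
def Hom.precomp {F G : GrMod 𝒜} (f : F.Hom G) (N : GrMod 𝒜) (hF : F.IsGrFree)
    (hG : G.IsGrFree) : (G.homGr N hG).Hom (F.homGr N hF) where
  toLin := LinearMap.lcomp S N.carrier f.toLin
  map_deg := fun hφ c x hx => hφ c (f.toLin x) (f.map_deg hx)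

theorem Hom.isHomog_range {M N : GrMod 𝒜} (f : M.Hom N) :
    N.IsHomog (LinearMap.range f.toLin) := by
  rintro _ ⟨z, rfl⟩ a
  exact ⟨M.proj a z, (f.proj_comm a z).symm⟩

theorem isHomog_bot (M : GrMod 𝒜) : M.IsHomog ⊥ := by
  intro z hz a
  rw [Submodule.mem_bot] at hz ⊢
  rw [hz, map_zero]

end GrMod

/-- A free graded `S`-complex `F_0 ← F_1 ← F_2 ← ⋯`: all `F_i` are finitely generated graded free
modules and all differentials are homogeneous of degree `0`. -/
structure FreeComplex (𝒜 : A → Submodule k S) [GradedAlgebra 𝒜] where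
  X : ℕ → GrMod 𝒜
  free : ∀ i, (X i).IsGrFree
  d : ∀ i, (X (i + 1)).Hom (X i)
  d_comp_d : ∀ i, (d i).toLin ∘ₗ (d (i + 1)).toLin = 0

namespace FreeComplex

variable {𝒜 : A → Submodule k S} [GradedAlgebra 𝒜]

/-- The coboundary map `Hom_S(F_i, N) → Hom_S(F_{i+1}, N)` of the complex `Hom_S(F, N)`. -/
def coboundary (F : FreeComplex 𝒜) (N : GrMod 𝒜) (i : ℕ) :
    ((F.X i).homGr N (F.free i)).Hom ((F.X (i + 1)).homGr N (F.free (i + 1))) :=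
  (F.d i).precomp N _ _

/-- The image of `Hom_S(F_{i-1}, N) → Hom_S(F_i, N)`, which is zero for `i = 0`. -/
def coboundaries (F : FreeComplex 𝒜) (N : GrMod 𝒜) :
    ∀ i, Submodule S ((F.X i).homGr N (F.free i)).carrier
  | 0 => ⊥
  | i + 1 => LinearMap.range (F.coboundary N i).toLin

theorem isHomog_coboundaries (F : FreeComplex 𝒜) (N : GrMod 𝒜) :
    ∀ i, ((F.X i).homGr N (F.free i)).IsHomog (F.coboundaries N i)
  | 0 => GrMod.isHomog_bot _
  | i + 1 => (F.coboundary N i).isHomog_range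

/-- The graded `S`-module `H^i(Hom_S(F, N))`. -/
def homCohomology (F : FreeComplex 𝒜) (N : GrMod 𝒜) (i : ℕ) : GrMod 𝒜 :=
  ((F.X i).homGr N (F.free i)).subquotient (LinearMap.ker (F.coboundary N i).toLin)
    (F.coboundaries N i) (F.coboundary N i).isHomog_ker (F.isHomog_coboundaries N i)

/-- The complex has length at most `l`, i.e. `F_i = 0` for `i > l`. -/
def LengthLE (F : FreeComplex 𝒜) (l : ℕ) : Prop :=
  ∀ i, l < i → Subsingleton (F.X i).carrier

end FreeComplex

/-! ### The graded module `Ext` -/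

namespace GrMod

variable (𝒜 : A → Submodule k S) [GradedAlgebra 𝒜]

/-- The graded free module `⨁_j S(-d j)`. -/
def free {n : ℕ} (d : Fin n → A) : GrMod 𝒜 where
  carrier := Fin n → S
  deg a :=
    { carrier := {v | ∀ j, v j ∈ 𝒜 (a - d j)}
      add_mem' := fun hv hw j => add_mem (hv j) (hw j)
      zero_mem' := fun _ => zero_mem _
      neg_mem' := fun hv j => neg_mem (hv j) }
  isInternal := by
    classical
    refine isInternal_of_sum _ ?_ ?_
    · intro v
      choose s hs using fun j => exists_sum_decompose (𝒜 := 𝒜) (v j)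
      refine ⟨Finset.univ.biUnion fun j => (s j).image fun a => a + d j,
        fun a j => (DirectSum.decompose 𝒜 (v j) (a - d j) : S), fun a j => SetLike.coe_mem _, ?_⟩
      funext j
      rw [Finset.sum_apply]
      have h : s j ⊆ (Finset.univ.biUnion fun j => (s j).image fun a => a + d j).image
          fun a => a - d j := by
        intro e he
        refine Finset.mem_image.2 ⟨e + d j, Finset.mem_biUnion.2 ⟨j, Finset.mem_univ _, ?_⟩, by abel⟩
        exact Finset.mem_image_of_mem _ he
      have h' := hs j _ h
      rwa [Finset.sum_image (fun x _ y _ hxy => sub_left_injective hxy)] at h'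
    · intro s f hf h a ha
      funext j
      have h0 : ∑ b ∈ s, f b j = 0 := by simpa using congrFun h j
      have h1 := congrArg (GradedRing.proj 𝒜 (a - d j)) h0
      rw [map_sum, map_zero, Finset.sum_eq_single_of_mem a ha] at h1
      · rw [GradedRing.proj_apply, DirectSum.decompose_of_mem_same 𝒜 (hf a j)] at h1
        exact h1
      · intro b _ hb
        rw [GradedRing.proj_apply]
        exact DirectSum.decompose_of_mem_ne 𝒜 (hf b j) fun h => hb (sub_left_injective h)
  smul_mem := by
    intro a b s v hs hv j
    have := SetLike.mul_mem_graded hs (hv j)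
    rwa [← add_sub_assoc] at this

theorem free_isGrFree {n : ℕ} (d : Fin n → A) : (free 𝒜 d).IsGrFree := by
  refine ⟨n, Pi.basisFun S (Fin n), d, fun j i => ?_⟩
  have h0 : Pi.basisFun S (Fin n) j i = (Pi.single j 1 : Fin n → S) i := by
    rw [Pi.basisFun_apply]
  refine (congrArg (· ∈ 𝒜 (d j - d i)) h0).mpr ?_
  by_cases h : i = j
  · subst h
    rw [Pi.single_eq_same, sub_self]
    exact SetLike.one_mem_graded 𝒜
  · rw [Pi.single_eq_of_ne h]
    exact zero_mem _

variable {𝒜}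

/-- A finitely generated graded module is generated by finitely many homogeneous elements. -/
theorem exists_generators (M : GrMod 𝒜) (hM : Module.Finite S M.carrier) :
    ∃ (n : ℕ) (g : Fin n → M.carrier) (d : Fin n → A), (∀ j, g j ∈ M.deg (d j)) ∧
      Submodule.span S (Set.range g) = ⊤ := by
  classical
  obtain ⟨s, hs⟩ := hM.fg_top
  choose t ht using fun m => M.exists_sum_proj m
  let T : Finset (M.carrier × A) := s.biUnion fun m => (t m).image fun a => (M.proj a m, a)
  let e := T.equivFin.symm
  have hT : ∀ p ∈ T, p.1 ∈ M.deg p.2 := by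
    intro p hp
    obtain ⟨m, _, hp⟩ := Finset.mem_biUnion.1 hp
    obtain ⟨a, _, rfl⟩ := Finset.mem_image.1 hp
    exact M.proj_mem a m
  refine ⟨T.card, fun j => (e j).1.1, fun j => (e j).1.2, fun j => hT _ (e j).2, ?_⟩
  rw [eq_top_iff, ← hs, Submodule.span_le]
  intro m hm
  rw [SetLike.mem_coe, ← ht m _ subset_rfl]
  refine sum_mem fun a ha => Submodule.subset_span ?_
  have hp : (M.proj a m, a) ∈ T :=
    Finset.mem_biUnion.2 ⟨m, hm, Finset.mem_image_of_mem _ ha⟩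
  exact ⟨e.symm ⟨_, hp⟩, by simp⟩

/-- A finitely generated graded free module that surjects onto the finitely generated graded
module `M`: it has one generator for each member of a finite system of homogeneous generators. -/
def cover (M : GrMod 𝒜) (hM : Module.Finite S M.carrier) : GrMod 𝒜 :=
  free 𝒜 (M.exists_generators hM).choose_spec.choose_spec.choose

/-- The surjection from the graded free cover. -/
def coverMap (M : GrMod 𝒜) (hM : Module.Finite S M.carrier) : (M.cover hM).Hom M where
  toLin := Fintype.linearCombination S (M.exists_generators hM).choose_spec.choose
  map_deg := by
    intro a v hv
    refine (congrArg (· ∈ M.deg a) (Fintype.linearCombination_apply S _ v)).mpr ?_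
    refine sum_mem fun j _ => ?_
    have := M.smul_mem (hv j) ((M.exists_generators hM).choose_spec.choose_spec.choose_spec.1 j)
    rwa [sub_add_cancel] at this

theorem coverMap_surjective (M : GrMod 𝒜) (hM : Module.Finite S M.carrier) :
    Function.Surjective (M.coverMap hM).toLin := by
  rw [← LinearMap.range_eq_top]
  exact (Fintype.range_linearCombination S _).trans
    (M.exists_generators hM).choose_spec.choose_spec.choose_spec.2

variable [IsNoetherianRing S]

/-- The kernel of the graded free cover, a first syzygy module of `M`. -/
def kerCover (M : GrMod 𝒜) (hM : Module.Finite S M.carrier) : GrMod 𝒜 :=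
  (M.cover hM).ofSubmodule (LinearMap.ker (M.coverMap hM).toLin) (M.coverMap hM).isHomog_ker

theorem kerCover_finite (M : GrMod 𝒜) (hM : Module.Finite S M.carrier) :
    Module.Finite S (M.kerCover hM).carrier :=
  inferInstanceAs (Module.Finite S
    (LinearMap.ker (Fintype.linearCombination S (M.exists_generators hM).choose_spec.choose)))

/-- The inclusion of the syzygy module. -/
def kerCoverIncl (M : GrMod 𝒜) (hM : Module.Finite S M.carrier) :
    (M.kerCover hM).Hom (M.cover hM) where
  toLin := (LinearMap.ker (M.coverMap hM).toLin).subtype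
  map_deg := fun h => h

/-- The iterated syzygy modules of `M`. -/
def syzygy (M : GrMod 𝒜) (hM : Module.Finite S M.carrier) :
    ℕ → {K : GrMod 𝒜 // Module.Finite S K.carrier}
  | 0 => ⟨M, hM⟩
  | i + 1 => ⟨(syzygy M hM i).1.kerCover (syzygy M hM i).2,
      (syzygy M hM i).1.kerCover_finite (syzygy M hM i).2⟩

/-- The graded free cover `F_i` of the `i`-th syzygy module. -/
def syzygyCover (M : GrMod 𝒜) (hM : Module.Finite S M.carrier) (i : ℕ) : GrMod 𝒜 :=
  (M.syzygy hM i).1.cover (M.syzygy hM i).2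

/-- The surjection from `F_i` onto the `i`-th syzygy module. -/
def syzygyCoverMap (M : GrMod 𝒜) (hM : Module.Finite S M.carrier) (i : ℕ) :
    (M.syzygyCover hM i).Hom (M.syzygy hM i).1 :=
  (M.syzygy hM i).1.coverMap (M.syzygy hM i).2

/-- The inclusion of the `(i + 1)`-st syzygy module into `F_i`. -/
def syzygyIncl (M : GrMod 𝒜) (hM : Module.Finite S M.carrier) (i : ℕ) :
    (M.syzygy hM (i + 1)).1.Hom (M.syzygyCover hM i) :=
  (M.syzygy hM i).1.kerCoverIncl (M.syzygy hM i).2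

theorem syzygyCoverMap_surjective (M : GrMod 𝒜) (hM : Module.Finite S M.carrier) (i : ℕ) :
    Function.Surjective (M.syzygyCoverMap hM i).toLin :=
  coverMap_surjective _ _

theorem syzygyIncl_injective (M : GrMod 𝒜) (hM : Module.Finite S M.carrier) (i : ℕ) :
    Function.Injective (M.syzygyIncl hM i).toLin :=
  Subtype.val_injective

theorem syzygy_exact (M : GrMod 𝒜) (hM : Module.Finite S M.carrier) (i : ℕ) :
    Function.Exact (M.syzygyIncl hM i).toLin (M.syzygyCoverMap hM i).toLin := fun y =>
  ⟨fun h => ⟨⟨y, h⟩, rfl⟩, fun ⟨x, hx⟩ => hx ▸ x.2⟩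

/-- A graded free resolution of the finitely generated graded module `M`, obtained by covering
`M` and its successive syzygy modules by finitely generated graded free modules. -/
def freeResolution (M : GrMod 𝒜) (hM : Module.Finite S M.carrier) : FreeComplex 𝒜 where
  X i := M.syzygyCover hM i
  free i := free_isGrFree 𝒜 _
  d i := (M.syzygyIncl hM i).comp (M.syzygyCoverMap hM (i + 1))
  d_comp_d i := by
    ext1 x
    have h := (M.syzygy_exact hM (i + 1)).apply_apply_eq_zero
      ((M.syzygyCoverMap hM (i + 2)).toLin x)
    change (M.syzygyIncl hM i).toLin ((M.syzygyCoverMap hM (i + 1)).toLin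
      ((M.syzygyIncl hM (i + 1)).toLin ((M.syzygyCoverMap hM (i + 2)).toLin x))) = 0
    rw [h, map_zero]

/-- The complex `freeResolution M` is exact in positive degrees. -/
theorem freeResolution_exact (M : GrMod 𝒜) (hM : Module.Finite S M.carrier) (i : ℕ) :
    Function.Exact ((M.freeResolution hM).d (i + 1)).toLin ((M.freeResolution hM).d i).toLin := by
  intro y
  constructor
  · intro h
    have h1 : (M.syzygyCoverMap hM (i + 1)).toLin y = 0 :=
      M.syzygyIncl_injective hM i (h.trans (map_zero _).symm)
    obtain ⟨z, rfl⟩ := (M.syzygy_exact hM (i + 1) y).1 h1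
    obtain ⟨x, rfl⟩ := M.syzygyCoverMap_surjective hM (i + 2) z
    exact ⟨x, rfl⟩
  · rintro ⟨x, rfl⟩
    exact LinearMap.congr_fun ((M.freeResolution hM).d_comp_d i) x

/-- The augmentation `F_0 → M` of `freeResolution M`. -/
def freeResolutionAug (M : GrMod 𝒜) (hM : Module.Finite S M.carrier) :
    ((M.freeResolution hM).X 0).Hom M :=
  M.syzygyCoverMap hM 0

theorem freeResolutionAug_surjective (M : GrMod 𝒜) (hM : Module.Finite S M.carrier) :
    Function.Surjective (M.freeResolutionAug hM).toLin :=
  M.syzygyCoverMap_surjective hM 0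

/-- The kernel of the augmentation is the image of `F_1 → F_0`. -/
theorem freeResolutionAug_exact (M : GrMod 𝒜) (hM : Module.Finite S M.carrier) :
    Function.Exact ((M.freeResolution hM).d 0).toLin (M.freeResolutionAug hM).toLin := by
  intro y
  constructor
  · intro h
    obtain ⟨z, rfl⟩ := (M.syzygy_exact hM 0 y).1 h
    obtain ⟨x, rfl⟩ := M.syzygyCoverMap_surjective hM 1 z
    exact ⟨x, rfl⟩
  · rintro ⟨x, rfl⟩
    exact (M.syzygy_exact hM 0).apply_apply_eq_zero ((M.syzygyCoverMap hM 1).toLin x)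

/-- The graded `S`-module `Ext^i_S(M, N)`, for a finitely generated graded module `M`: the `i`-th
cohomology of `Hom_S(G, N)` for a graded free resolution `G` of `M`. -/
def gradedExt (M N : GrMod 𝒜) [hM : Module.Finite S M.carrier] (i : ℕ) : GrMod 𝒜 :=
  (M.freeResolution hM).homCohomology N i

end GrMod

/-! ### The multigraded homogeneous spectrum and the sheaves `M^~` -/

variable (𝒜 : A → Submodule k S) (B : Ideal S)

section Sheaves

variable [GradedAlgebra 𝒜]

/-- The homogeneous prime ideals of `S` that do not contain the ideal `B`, with the Zariski
topology. -/
def RelSpec : Type u :=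
  {P : PrimeSpectrum S // P.asIdeal.IsHomogeneous 𝒜 ∧ ¬ B ≤ P.asIdeal}

instance : TopologicalSpace (RelSpec 𝒜 B) :=
  instTopologicalSpaceSubtype (p := fun P : PrimeSpectrum S =>
    P.asIdeal.IsHomogeneous 𝒜 ∧ ¬ B ≤ P.asIdeal)

/-- `RelSpec` as an object of the category of topological spaces. -/
abbrev RelSpec.top : TopCat.{u} := TopCat.of (RelSpec 𝒜 B)

variable {𝒜 B}

/-- The prime ideal belonging to a point. -/
def RelSpec.ideal (P : RelSpec 𝒜 B) : Ideal S := P.1.asIdeal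

instance (P : RelSpec 𝒜 B) : P.ideal.IsPrime := P.1.isPrime

/-- The localization of an `S`-module at the prime ideal `P`. -/
abbrev RelSpec.Loc (P : RelSpec 𝒜 B) (M : Type u) [AddCommGroup M] [Module S M] : Type u :=
  LocalizedModule P.ideal.primeCompl M

/-- A family of germs `f x ∈ M_x` is a homogeneous fraction of degree `0` on `U` if it is of the
form `m / s` with `m ∈ M` and `s ∈ S` homogeneous of the same degree and `s` outside of all the
primes in `U`. -/
def IsHomFraction {M : Type u} [AddCommGroup M] [Module S M] (deg : A → AddSubgroup M)
    {U : Opens (RelSpec 𝒜 B)} (f : ∀ x : U, x.1.Loc M) : Prop :=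
  ∃ a : A, ∃ m ∈ deg a, ∃ s ∈ 𝒜 a, ∀ x : U, ∃ hs : s ∈ x.1.ideal.primeCompl,
    f x = LocalizedModule.mk m ⟨s, hs⟩

/-- Being locally a homogeneous fraction of degree `0`. -/
def IsLocHomFraction {M : Type u} [AddCommGroup M] [Module S M] (deg : A → AddSubgroup M)
    {U : Opens (RelSpec 𝒜 B)} (f : ∀ x : U, x.1.Loc M) : Prop :=
  ∀ x : U, ∃ (V : Opens (RelSpec 𝒜 B)) (_ : x.1 ∈ V) (i : V ≤ U),
    IsHomFraction deg fun y : V => f ⟨y.1, i y.2⟩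

/-- The degree components of `S` as additive subgroups. -/
def ringDeg (𝒜 : A → Submodule k S) (a : A) : AddSubgroup S := (𝒜 a).toAddSubgroup

theorem ringDeg_mul {a b : A} {s t : S} (hs : s ∈ 𝒜 a) (ht : t ∈ 𝒜 b) :
    s * t ∈ ringDeg 𝒜 (a + b) :=
  SetLike.mul_mem_graded (A := 𝒜) hs ht

/-- The ring `Γ(U, 𝒪)` of functions on `U` that are locally homogeneous fractions of degree `0`. -/
def ringSections (U : Opens (RelSpec 𝒜 B)) : Subring (∀ x : U, x.1.Loc S) where
  carrier := {f | IsLocHomFraction (ringDeg 𝒜) f}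
  zero_mem' x := ⟨U, x.2, le_rfl, 0, 0, zero_mem _, 1, SetLike.one_mem_graded 𝒜, fun y =>
    ⟨one_mem _, (LocalizedModule.zero_mk _).symm⟩⟩
  one_mem' x := ⟨U, x.2, le_rfl, 0, 1, SetLike.one_mem_graded 𝒜, 1, SetLike.one_mem_graded 𝒜,
    fun y => ⟨one_mem _, OreLocalization.one_def⟩⟩
  add_mem' {f g} hf hg x := by
    obtain ⟨V, hV, iV, a, m, hm, s, hs, h⟩ := hf x
    obtain ⟨W, hW, iW, b, n, hn, t, ht, h'⟩ := hg x
    refine ⟨V ⊓ W, ⟨hV, hW⟩, inf_le_left.trans iV, a + b, t • m + s • n, ?_, s * t,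
      SetLike.mul_mem_graded hs ht, fun y => ?_⟩
    · refine add_mem ?_ (ringDeg_mul hs hn)
      rw [add_comm a b]
      exact ringDeg_mul ht hm
    · obtain ⟨h1, h2⟩ := h ⟨y.1, y.2.1⟩
      obtain ⟨h3, h4⟩ := h' ⟨y.1, y.2.2⟩
      exact ⟨mul_mem h1 h3, (congrArg₂ (· + ·) h2 h4).trans LocalizedModule.mk_add_mk⟩
  neg_mem' {f} hf x := by
    obtain ⟨V, hV, iV, a, m, hm, s, hs, h⟩ := hf x
    refine ⟨V, hV, iV, a, -m, neg_mem hm, s, hs, fun y => ?_⟩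
    obtain ⟨h1, h2⟩ := h y
    exact ⟨h1, (congrArg (- ·) h2).trans LocalizedModule.mk_neg.symm⟩
  mul_mem' {f g} hf hg x := by
    obtain ⟨V, hV, iV, a, m, hm, s, hs, h⟩ := hf x
    obtain ⟨W, hW, iW, b, n, hn, t, ht, h'⟩ := hg x
    refine ⟨V ⊓ W, ⟨hV, hW⟩, inf_le_left.trans iV, a + b, m * n, ringDeg_mul hm hn,
      s * t, SetLike.mul_mem_graded hs ht, fun y => ?_⟩
    obtain ⟨h1, h2⟩ := h ⟨y.1, y.2.1⟩
    obtain ⟨h3, h4⟩ := h' ⟨y.1, y.2.2⟩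
    exact ⟨mul_mem h1 h3, (congrArg₂ (· * ·) h2 h4).trans LocalizedModule.mk_mul_mk⟩

/-- The group `Γ(U, M^~)` of families of germs on `U` that are locally homogeneous fractions of
degree `0`. -/
def modSections (M : GrMod 𝒜) (U : Opens (RelSpec 𝒜 B)) :
    Submodule (ringSections U) (∀ x : U, x.1.Loc M.carrier) where
  carrier := {f | IsLocHomFraction M.deg f}
  zero_mem' x := ⟨U, x.2, le_rfl, 0, 0, zero_mem _, 1, SetLike.one_mem_graded 𝒜, fun y =>
    ⟨one_mem _, (LocalizedModule.zero_mk _).symm⟩⟩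
  add_mem' {f g} hf hg x := by
    obtain ⟨V, hV, iV, a, m, hm, s, hs, h⟩ := hf x
    obtain ⟨W, hW, iW, b, n, hn, t, ht, h'⟩ := hg x
    refine ⟨V ⊓ W, ⟨hV, hW⟩, inf_le_left.trans iV, a + b, t • m + s • n, ?_, s * t,
      SetLike.mul_mem_graded hs ht, fun y => ?_⟩
    · refine add_mem ?_ (M.smul_mem hs hn)
      rw [add_comm a b]
      exact M.smul_mem ht hm
    · obtain ⟨h1, h2⟩ := h ⟨y.1, y.2.1⟩
      obtain ⟨h3, h4⟩ := h' ⟨y.1, y.2.2⟩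
      exact ⟨mul_mem h1 h3, (congrArg₂ (· + ·) h2 h4).trans LocalizedModule.mk_add_mk⟩
  smul_mem' r f hf x := by
    obtain ⟨V, hV, iV, a, m, hm, s, hs, h⟩ := (show IsLocHomFraction (ringDeg 𝒜) r.1 from r.2) x
    obtain ⟨W, hW, iW, b, n, hn, t, ht, h'⟩ := hf x
    refine ⟨V ⊓ W, ⟨hV, hW⟩, inf_le_left.trans iV, a + b, m • n, M.smul_mem hm hn,
      s * t, SetLike.mul_mem_graded hs ht, fun y => ?_⟩
    obtain ⟨h1, h2⟩ := h ⟨y.1, y.2.1⟩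
    obtain ⟨h3, h4⟩ := h' ⟨y.1, y.2.2⟩
    exact ⟨mul_mem h1 h3, (congrArg₂ (· • ·) h2 h4).trans (LocalizedModule.mk_smul_mk _ _ _ _)⟩

/-- The type of functions on `U`. -/
def RingSec (U : Opens (RelSpec 𝒜 B)) : Type u := ringSections U

/-- The type of sections of `M^~` on `U`. -/
def ModSec (M : GrMod 𝒜) (U : Opens (RelSpec 𝒜 B)) : Type u := modSections M U

instance (U : Opens (RelSpec 𝒜 B)) : CommRing (RingSec U) :=
  inferInstanceAs (CommRing (ringSections U))

instance (M : GrMod 𝒜) (U : Opens (RelSpec 𝒜 B)) : AddCommGroup (ModSec M U) :=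
  (modSections M U).addCommGroup

instance (M : GrMod 𝒜) (U : Opens (RelSpec 𝒜 B)) : Module (RingSec U) (ModSec M U) :=
  (modSections M U).module

theorem IsLocHomFraction.res {M : Type u} [AddCommGroup M] [Module S M] {deg : A → AddSubgroup M}
    {U V : Opens (RelSpec 𝒜 B)} (i : V ≤ U) {f : ∀ x : U, x.1.Loc M}
    (hf : IsLocHomFraction deg f) :
    IsLocHomFraction deg (U := V) fun x => f ⟨x.1, i x.2⟩ := fun x => by
  obtain ⟨W, hW, iW, a, m, hm, s, hs, h⟩ := hf ⟨x.1, i x.2⟩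
  exact ⟨V ⊓ W, ⟨x.2, hW⟩, inf_le_left, a, m, hm, s, hs, fun y => h ⟨y.1, y.2.2⟩⟩

/-- Restriction of functions. -/
def ringRes {U V : Opens (RelSpec 𝒜 B)} (i : V ≤ U) : RingSec U →+* RingSec V where
  toFun f := ⟨fun x => f.1 ⟨x.1, i x.2⟩, IsLocHomFraction.res i f.2⟩
  map_one' := rfl
  map_mul' _ _ := rfl
  map_zero' := rfl
  map_add' _ _ := rfl

/-- Restriction of sections. -/
def modRes (M : GrMod 𝒜) {U V : Opens (RelSpec 𝒜 B)} (i : V ≤ U) :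
    ModSec M U →+ ModSec M V where
  toFun f := ⟨fun x => f.1 ⟨x.1, i x.2⟩, IsLocHomFraction.res i f.2⟩
  map_zero' := rfl
  map_add' _ _ := rfl

theorem modRes_smul (M : GrMod 𝒜) {U V : Opens (RelSpec 𝒜 B)} (i : V ≤ U) (r : RingSec U)
    (m : ModSec M U) : modRes M i (r • m) = ringRes i r • modRes M i m := rfl

variable (𝒜 B) in
/-- The structure presheaf. -/
def ringPresheaf : (Opens (RelSpec.top 𝒜 B))ᵒᵖ ⥤ RingCat.{u} where
  obj U := RingCat.of (RingSec (𝒜 := 𝒜) (B := B) U.unop)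
  map i := RingCat.ofHom (ringRes i.unop.le)
  map_id _ := rfl
  map_comp _ _ := rfl

/-- The presheaf of abelian groups underlying `M^~`. -/
def abPresheaf (M : GrMod 𝒜) : (Opens (RelSpec.top 𝒜 B))ᵒᵖ ⥤ Ab.{u} where
  obj U := AddCommGrpCat.of (ModSec (B := B) M U.unop)
  map i := AddCommGrpCat.ofHom (modRes M i.unop.le)
  map_id _ := rfl
  map_comp _ _ := rfl

instance (M : GrMod 𝒜) (U : (Opens (RelSpec.top 𝒜 B))ᵒᵖ) :
    Module ((ringPresheaf 𝒜 B).obj U) ((abPresheaf (B := B) M).obj U) :=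
  inferInstanceAs (Module (RingSec (𝒜 := 𝒜) (B := B) U.unop) (ModSec (B := B) M U.unop))

/-- The presheaf of modules `M^~`. -/
def modPresheaf (M : GrMod 𝒜) : PresheafOfModules.{u} (ringPresheaf 𝒜 B) :=
  .ofPresheaf (abPresheaf M) fun _ _ i r m => modRes_smul M i.unop.le r m

variable (𝒜 B) in
/-- Being locally a homogeneous fraction of degree `0`, as a local predicate. -/
def locHomFraction {M : Type u} [AddCommGroup M] [Module S M] (deg : A → AddSubgroup M) :
    TopCat.LocalPredicate (X := RelSpec.top 𝒜 B) (fun x => RelSpec.Loc (𝒜 := 𝒜) (B := B) x M) where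
  pred {U} f := IsLocHomFraction (U := U) deg f
  res i _ hf := hf.res i.le
  locality {U} f hf x := by
    obtain ⟨V, hV, i, h⟩ := hf x
    obtain ⟨W, hW, iW, h'⟩ := h ⟨x.1, hV⟩
    exact ⟨W, hW, iW.trans i.le, h'⟩

theorem ringPresheaf_isSheaf : TopCat.Presheaf.IsSheaf (ringPresheaf 𝒜 B) :=
  (TopCat.Presheaf.isSheaf_iff_isSheaf_comp (forget RingCat) _).2
    (TopCat.subsheafToTypes (locHomFraction 𝒜 B (ringDeg 𝒜))).2

theorem abPresheaf_isSheaf (M : GrMod 𝒜) : TopCat.Presheaf.IsSheaf (abPresheaf (B := B) M) :=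
  (TopCat.Presheaf.isSheaf_iff_isSheaf_comp (forget Ab) _).2
    (TopCat.subsheafToTypes (locHomFraction 𝒜 B M.deg)).2

variable (𝒜 B) in
/-- The structure sheaf `𝒪`. -/
def structureSheaf : Sheaf (Opens.grothendieckTopology (RelSpec.top 𝒜 B)) RingCat.{u} :=
  ⟨ringPresheaf 𝒜 B, ringPresheaf_isSheaf⟩

variable (B) in
/-- The sheaf of `𝒪`-modules `M^~`. -/
def tilde (M : GrMod 𝒜) : SheafOfModules.{u} (structureSheaf 𝒜 B) where
  val := modPresheaf M
  isSheaf := abPresheaf_isSheaf M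

/-- The action of a graded homomorphism on sections. -/
def tildeMapSections {M N : GrMod 𝒜} (f : M.Hom N) (U : Opens (RelSpec 𝒜 B)) :
    ModSec M U →ₗ[RingSec U] ModSec N U where
  toFun s := ⟨fun x => LocalizedModule.map x.1.ideal.primeCompl f.toLin (s.1 x), fun x => by
    obtain ⟨V, hV, i, a, m, hm, t, ht, h⟩ := (show IsLocHomFraction M.deg s.1 from s.2) x
    refine ⟨V, hV, i, a, f.toLin m, f.map_deg hm, t, ht, fun y => ?_⟩
    obtain ⟨h1, h2⟩ := h y
    exact ⟨h1, (congrArg _ h2).trans (LocalizedModule.map_mk _ _ _ _)⟩⟩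
  map_add' s t := Subtype.ext <| funext fun x => map_add _ _ _
  map_smul' r s := Subtype.ext <| funext fun x => map_smul _ (r.1 x) _

variable (B) in
/-- The morphism of sheaves of `𝒪`-modules `M^~ → N^~` induced by a graded homomorphism. -/
def tildeMap {M N : GrMod 𝒜} (f : M.Hom N) : tilde B M ⟶ tilde B N where
  val := PresheafOfModules.homMk
    { app := fun U => AddCommGrpCat.ofHom (tildeMapSections f U.unop).toAddMonoidHom
      naturality := fun _ _ _ => rfl } fun U r m => (tildeMapSections f U.unop).map_smul r m

end Sheaves

/-! ### Virtual resolutions -/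

/-- A morphism of sheaves of modules on a topological space is surjective (as a morphism of
sheaves): every section of the target lifts locally. -/
def SheafSurjective {T : TopCat.{u}} {R : Sheaf (Opens.grothendieckTopology T) RingCat.{u}}
    {P Q : SheafOfModules.{u} R} (φ : P ⟶ Q) : Prop :=
  ∀ (U : Opens T) (t : Q.val.presheaf.obj (op U)), ∀ x ∈ U,
    ∃ (V : Opens T) (_ : x ∈ V) (i : V ⟶ U) (s : P.val.presheaf.obj (op V)),
      φ.val.app (op V) s = Q.val.presheaf.map i.op t

/-- Exactness of `P ⟶ Q ⟶ L` as a sequence of sheaves of modules on a topological space: the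
composition is zero, and every section of `Q` that is killed by `ψ` lifts locally to `P`. -/
def SheafExact {T : TopCat.{u}} {R : Sheaf (Opens.grothendieckTopology T) RingCat.{u}}
    {P Q L : SheafOfModules.{u} R} (φ : P ⟶ Q) (ψ : Q ⟶ L) : Prop :=
  φ ≫ ψ = 0 ∧ ∀ (U : Opens T) (t : Q.val.presheaf.obj (op U)), ψ.val.app (op U) t = 0 →
    ∀ x ∈ U, ∃ (V : Opens T) (_ : x ∈ V) (i : V ⟶ U) (s : P.val.presheaf.obj (op V)),
      φ.val.app (op V) s = Q.val.presheaf.map i.op t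

/-- The free graded complex `F` is a virtual resolution of `M`: for a suitable morphism of
sheaves `F_0^~ → M^~`, the sequence `0 ← M^~ ← F_0^~ ← F_1^~ ← ⋯` of sheaves is exact. -/
def IsVirtualResolution {𝒜 : A → Submodule k S} [GradedAlgebra 𝒜] (B : Ideal S)
    (F : FreeComplex 𝒜) (M : GrMod 𝒜) : Prop :=
  ∃ ε : tilde B (F.X 0) ⟶ tilde B M, SheafSurjective ε ∧
    SheafExact (tildeMap B (F.d 0)) ε ∧
    ∀ i, SheafExact (tildeMap B (F.d (i + 1))) (tildeMap B (F.d i))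

end GradedModules

/-! ### Smooth projective toric varieties and their Cox rings -/

/-- The cone in `ℝ^n` generated by the vectors `ray i` with `i ∈ σ`. -/
def coneSpan {n : ℕ} {ι : Type} [Fintype ι] (ray : ι → Fin n → ℤ) (σ : Finset ι) :
    Set (Fin n → ℝ) :=
  {v | ∃ c : ι → ℝ, (∀ i, 0 ≤ c i) ∧ (∀ i, i ∉ σ → c i = 0) ∧
    v = ∑ i, c i • fun j => (ray i j : ℝ)}

/-- The fan in `ℝ^n`, with respect to the lattice `ℤ^n`, of a smooth projective toric variety of
dimension `n`. It is given by the primitive generators `ray i` of its rays and by the sets of rays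
of its maximal cones. -/
structure SmoothProjectiveFan (n : ℕ) (ι : Type) [Fintype ι] [DecidableEq ι] where
  ray : ι → Fin n → ℤ
  maxCones : Set (Finset ι)
  /-- every ray belongs to a cone -/
  exists_mem : ∀ i, ∃ σ ∈ maxCones, i ∈ σ
  /-- smoothness: the generators of a maximal cone form a basis of the lattice -/
  linearIndependent : ∀ σ ∈ maxCones, LinearIndependent ℤ fun i : σ => ray i
  span_eq_top : ∀ σ ∈ maxCones, Submodule.span ℤ (Set.range fun i : σ => ray i) = ⊤
  /-- two cones meet in the common face that is generated by the common rays -/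
  inter_eq : ∀ σ ∈ maxCones, ∀ τ ∈ maxCones,
    coneSpan ray σ ∩ coneSpan ray τ = coneSpan ray (σ ∩ τ)
  /-- completeness: the cones cover `ℝ^n` -/
  complete : ∀ v : Fin n → ℝ, ∃ σ ∈ maxCones, v ∈ coneSpan ray σ
  /-- projectivity: there is a torus-invariant divisor `∑ a i • D i` whose support function is
  strictly convex, i.e. which is ample -/
  projective : ∃ a : ι → ℤ, ∀ σ ∈ maxCones, ∃ m : Module.Dual ℤ (Fin n → ℤ),
    (∀ i ∈ σ, m (ray i) = -a i) ∧ ∀ i, i ∉ σ → -a i < m (ray i)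

namespace SmoothProjectiveFan

variable {n : ℕ} {ι : Type} [Fintype ι] [DecidableEq ι] (X : SmoothProjectiveFan n ι)

/-- The map that sends a character of the torus to its divisor, `m ↦ (⟨m, ray i⟩)_i`. -/
def divMap : Module.Dual ℤ (Fin n → ℤ) →ₗ[ℤ] (ι → ℤ) :=
  LinearMap.pi fun i => LinearMap.applyₗ (X.ray i)

/-- The Picard group of the toric variety (which equals its class group, by smoothness): the group
of torus-invariant divisors modulo the divisors of characters. -/
abbrev Pic : Type := (ι → ℤ) ⧸ LinearMap.range X.divMap

instance : DecidableEq X.Pic := Classical.decEq _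

/-- The class of the prime divisor that belongs to the ray `i`, which is the degree of the
`i`-th variable of the Cox ring. -/
def rayClass (i : ι) : X.Pic := Submodule.Quotient.mk (Pi.single i 1)

variable (k : Type u) [Field k]

/-- The grading of the Cox ring `k[x_i : i ∈ ι]` by the Picard group. -/
def coxGrading : X.Pic → Submodule k (MvPolynomial ι k) :=
  MvPolynomial.weightedHomogeneousSubmodule k X.rayClass

instance : GradedAlgebra (X.coxGrading k) :=
  MvPolynomial.weightedGradedAlgebra k X.rayClass

/-- The irrelevant ideal of the Cox ring, generated by the monomials `∏_{i ∉ σ} x_i` for the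
maximal cones `σ`. -/
def irrelevantIdeal : Ideal (MvPolynomial ι k) :=
  Ideal.span ((fun σ : Finset ι => ∏ i ∈ σᶜ, MvPolynomial.X i) '' X.maxCones)

/-- The toric variety of the fan over `k`, in Cox's homogeneous coordinates: the points of the
scheme are the `Pic`-homogeneous prime ideals of the Cox ring that do not contain the irrelevant
ideal. Its structure sheaf is `structureSheaf (X.coxGrading k) (X.irrelevantIdeal k)`. The affine
chart of a maximal cone `σ` is the set of points that do not contain `∏_{i ∉ σ} x_i`; there
`tilde` is given by the degree `0` part of the localization of the module at that monomial. -/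
abbrev variety : TopCat.{u} := RelSpec.top (X.coxGrading k) (X.irrelevantIdeal k)

/-- `Pic`-graded modules over the Cox ring. -/
abbrev CoxModule : Type (u + 1) := GrMod (X.coxGrading k)

variable {k}

/-- The sheaf on the toric variety that belongs to a graded module over the Cox ring. -/
abbrev sheaf (M : X.CoxModule k) :
    SheafOfModules.{u} (structureSheaf (X.coxGrading k) (X.irrelevantIdeal k)) :=
  tilde (X.irrelevantIdeal k) M

end SmoothProjectiveFan

end


/-!
At a point of `X` every degree of `S` contains a homogeneous element invertible in the graded
localization, so a compatible family of maps between the degree-zero parts of localizations extends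
to a degree-preserving linear map of the full graded localizations, its stalk map. Taking stalk maps
turns a virtual resolution into an honest resolution, by graded free modules, of each localization
of `M`.

Let `F` and `G` be two virtual resolutions of `M`. The comparison theorem gives a chain map between
the localizations of `F` and `G` at a point; since the terms are finitely generated, its components
are fractions over one homogeneous denominator that does not vanish at the point. The induced map on
the localized cohomology of `Hom(-, N)` does not depend on the choice of the chain map, because two
choices are homotopic after clearing denominators. It is an isomorphism, and near each point it is
given by a single fraction, so these maps are the stalks of an isomorphism of sheaves. A graded free
resolution of `M` is itself a virtual resolution, and `Hom(-, N)` of it computes `Ext`.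
-/

noncomputable section

variable {A : Type} [AddCommGroup A] [DecidableEq A] {k : Type u} {S : Type u} [CommRing k]
  [CommRing S] [Algebra k S] {𝒜 : A → Submodule k S} [GradedAlgebra 𝒜] {B : Ideal S}

/-! ### Localization at a point -/

namespace RelSpec

section Localization

variable (P : RelSpec 𝒜 B) {M N L : Type u} [AddCommGroup M] [Module S M] [AddCommGroup N]
  [Module S N] [AddCommGroup L] [Module S L]

/-- The canonical map from a module to its localization at a point. -/
abbrev toLoc (M : Type u) [AddCommGroup M] [Module S M] : M →ₗ[S] P.Loc M :=
  LocalizedModule.mkLinearMap P.ideal.primeCompl M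

variable {P}

theorem mul_notMem {s t : S} (hs : s ∉ P.ideal) (ht : t ∉ P.ideal) : s * t ∉ P.ideal :=
  P.ideal.primeCompl.mul_mem hs ht

variable (P) in
theorem one_notMem : (1 : S) ∉ P.ideal :=
  P.ideal.primeCompl.one_mem

theorem smul_left_cancel {s : S} (hs : s ∉ P.ideal) {x y : P.Loc M} (h : s • x = s • y) : x = y :=
  IsLocalizedModule.smul_injective (P.toLoc M) (⟨s, hs⟩ : P.ideal.primeCompl) h

theorem smul_mk (m : M) {r : S} (hr : r ∈ P.ideal.primeCompl) :
    r • (LocalizedModule.mk m ⟨r, hr⟩ : P.Loc M) = P.toLoc M m :=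
  (IsLocalizedModule.mk_eq_mk' (⟨r, hr⟩ : P.ideal.primeCompl) m).symm ▸
    IsLocalizedModule.mk'_cancel' (P.toLoc M) m ⟨r, hr⟩

theorem toLoc_eq_iff {m m' : M} :
    P.toLoc M m = P.toLoc M m' ↔ ∃ t, t ∉ P.ideal ∧ t • m = t • m' :=
  (IsLocalizedModule.eq_iff_exists P.ideal.primeCompl (P.toLoc M)).trans
    ⟨fun ⟨t, h⟩ => ⟨t, t.2, h⟩, fun ⟨t, ht, h⟩ => ⟨⟨t, ht⟩, h⟩⟩

theorem loc_hom_ext {φ ψ : P.Loc M →ₗ[P.Loc S] P.Loc N}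
    (h : ∀ m, φ (P.toLoc M m) = ψ (P.toLoc M m)) : φ = ψ :=
  (IsLocalizedModule.isBaseChange P.ideal.primeCompl (P.Loc S) (P.toLoc M)).algHom_ext _ _ h

variable (P) in
/-- The map `φ / t` on localizations at a point. -/
def fracMap (φ : M →ₗ[S] N) {t : S} (ht : t ∉ P.ideal) : P.Loc M →ₗ[P.Loc S] P.Loc N :=
  (LocalizedModule.mk 1 (⟨t, ht⟩ : P.ideal.primeCompl) : P.Loc S) •
    LocalizedModule.map P.ideal.primeCompl φ

theorem smul_fracMap_toLoc (φ : M →ₗ[S] N) {t : S} (ht : t ∉ P.ideal) (m : M) :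
    t • P.fracMap φ ht (P.toLoc M m) = P.toLoc N (φ m) := by
  have unit : t • (LocalizedModule.mk 1 (⟨t, ht⟩ : P.ideal.primeCompl) : P.Loc S) = 1 :=
    (smul_mk 1 ht).trans OreLocalization.one_def.symm
  rw [fracMap, LinearMap.smul_apply, ← smul_assoc, unit, one_smul]
  exact IsLocalizedModule.map_apply _ _ _ φ m

theorem fracMap_eq_iff {φ ψ : M →ₗ[S] N} {t u : S} (ht : t ∉ P.ideal) (hu : u ∉ P.ideal) :
    P.fracMap φ ht = P.fracMap ψ hu ↔ ∀ m, P.toLoc N (u • φ m) = P.toLoc N (t • ψ m) := by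
  have key (m : M) : P.toLoc N (u • φ m) = P.toLoc N (t • ψ m) ↔
      P.fracMap φ ht (P.toLoc M m) = P.fracMap ψ hu (P.toLoc M m) := by
    rw [map_smul, map_smul, ← smul_fracMap_toLoc φ ht, ← smul_fracMap_toLoc ψ hu, smul_comm u t]
    exact ⟨fun h => smul_left_cancel hu (smul_left_cancel ht h), fun h => by rw [h]⟩
  simp only [key]
  exact ⟨fun h m => by rw [h], loc_hom_ext⟩

theorem fracMap_comp (ψ : N →ₗ[S] L) (φ : M →ₗ[S] N) {t u : S} (hu : u ∉ P.ideal)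
    (ht : t ∉ P.ideal) :
    P.fracMap ψ hu ∘ₗ P.fracMap φ ht = P.fracMap (ψ ∘ₗ φ) (mul_notMem ht hu) := by
  refine loc_hom_ext fun m => smul_left_cancel (mul_notMem ht hu) ?_
  rw [smul_fracMap_toLoc, LinearMap.comp_apply, mul_comm, mul_smul, ← LinearMap.map_smul_of_tower,
    smul_fracMap_toLoc, smul_fracMap_toLoc, LinearMap.comp_apply]

theorem fracMap_id : P.fracMap (LinearMap.id : M →ₗ[S] M) P.one_notMem = LinearMap.id :=
  loc_hom_ext fun m => smul_left_cancel P.one_notMem <|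
    (smul_fracMap_toLoc _ P.one_notMem m).trans (one_smul S _).symm

end Localization
end RelSpec

/-! ### Homogeneous fractions -/

namespace GrMod

variable (𝒜) in
/-- The graded ring `S` as a graded module over itself. -/
abbrev self : GrMod 𝒜 where
  carrier := S
  deg := ringDeg 𝒜
  isInternal := DirectSum.Decomposition.isInternal 𝒜
  smul_mem := ringDeg_mul

variable {M N : GrMod 𝒜} {P : RelSpec 𝒜 B} {a b : A}

/-- The homogeneous fractions of degree `a` in the localization `M_P`. Whether an element is of
this form is expressed by the existence of a homogeneous denominator, without a quotient. -/
def locDeg (M : GrMod 𝒜) (P : RelSpec 𝒜 B) (a : A) : AddSubgroup (P.Loc M.carrier) where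
  carrier := {z | ∃ b, ∃ t ∈ 𝒜 b, t ∉ P.ideal ∧ ∃ m ∈ M.deg (b + a), t • z = P.toLoc _ m}
  zero_mem' := ⟨0, 1, SetLike.one_mem_graded 𝒜, P.one_notMem, 0, zero_mem _, by simp⟩
  add_mem' := by
    rintro y z ⟨b, s, hs, hsP, m, hm, hy⟩ ⟨c, t, ht, htP, n, hn, hz⟩
    refine ⟨b + c, s * t, SetLike.mul_mem_graded hs ht, RelSpec.mul_notMem hsP htP,
      t • m + s • n, add_mem ?_ ?_, ?_⟩
    · exact (show b + c + a = c + (b + a) by abel) ▸ M.smul_mem ht hm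
    · exact (add_assoc b c a) ▸ M.smul_mem hs hn
    · rw [map_add, map_smul, map_smul, ← hy, ← hz, smul_add, mul_comm, mul_smul, mul_comm, mul_smul]
  neg_mem' := by
    rintro y ⟨b, s, hs, hsP, m, hm, hy⟩
    exact ⟨b, s, hs, hsP, -m, neg_mem hm, by rw [smul_neg, hy, map_neg]⟩

theorem toLoc_mem_locDeg {m : M.carrier} (hm : m ∈ M.deg a) : P.toLoc _ m ∈ M.locDeg P a :=
  ⟨0, 1, SetLike.one_mem_graded 𝒜, P.one_notMem, m, by rwa [zero_add], one_smul _ _⟩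

theorem smul_mem_locDeg {c : P.Loc S} {z : P.Loc M.carrier} (hc : c ∈ (self 𝒜).locDeg P a)
    (hz : z ∈ M.locDeg P b) : c • z ∈ M.locDeg P (a + b) := by
  obtain ⟨d, s, hs, hsP, r, hr, hc⟩ := hc
  obtain ⟨e, t, ht, htP, m, hm, hz⟩ := hz
  refine ⟨d + e, s * t, SetLike.mul_mem_graded hs ht, RelSpec.mul_notMem hsP htP, r • m, ?_, ?_⟩
  · exact (show d + e + (a + b) = d + a + (e + b) by abel) ▸ M.smul_mem hr hm
  · rw [mul_smul, smul_comm t c z, ← smul_assoc, hz, hc]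
    exact (algebraMap_smul (P.Loc S) r _).trans (map_smul _ r m).symm

theorem exists_decompose_notMem {t : S} (ht : t ∉ P.ideal) :
    ∃ c, (DirectSum.decompose 𝒜 t c : S) ∉ P.ideal := by
  by_contra! h
  obtain ⟨s, hs⟩ := exists_sum_decompose (𝒜 := 𝒜) t
  exact ht (hs s subset_rfl ▸ sum_mem fun c _ => h c)

theorem exists_homogeneous_smul_eq {m n : M.carrier} (hm : m ∈ M.deg a) (hn : n ∈ M.deg a)
    (h : P.toLoc _ m = P.toLoc _ n) : ∃ c, ∃ t ∈ 𝒜 c, t ∉ P.ideal ∧ t • m = t • n := by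
  obtain ⟨t, ht, h⟩ := RelSpec.toLoc_eq_iff.1 h
  obtain ⟨c, hc⟩ := exists_decompose_notMem ht
  refine ⟨c, _, SetLike.coe_mem _, hc, ?_⟩
  have := congrArg (M.proj (c + a)) h
  rwa [M.proj_smul t hm, M.proj_smul t hn, add_sub_cancel_right] at this

omit [GradedAlgebra 𝒜] in
theorem hom_ext {L : Type u} [AddCommGroup L] {φ ψ : M.carrier →+ L}
    (h : ∀ a, ∀ m ∈ M.deg a, φ m = ψ m) : φ = ψ := by
  ext m
  obtain ⟨s, hs⟩ := M.exists_sum_proj m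
  rw [← hs s subset_rfl, map_sum, map_sum]
  exact Finset.sum_congr rfl fun a _ => h a _ (M.proj_mem a m)

theorem exists_linearMap_of_deg {L : Type u} [AddCommGroup L] [Module S L]
    (E : ∀ a, M.deg a →+ L)
    (hE : ∀ {a c : A} {s : S} (hs : s ∈ 𝒜 c) (m : M.deg a),
      E (c + a) ⟨s • m.1, M.smul_mem hs m.2⟩ = s • E a m) :
    ∃ φ : M.carrier →ₗ[S] L, ∀ a (m : M.deg a), φ m = E a m := by
  let := M.isInternal.chooseDecomposition
  let φ : M.carrier →+ L :=
    (DirectSum.toAddMonoid E).comp (DirectSum.decomposeAddEquiv M.deg).toAddMonoidHom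
  have hφ (a) (m : M.deg a) : φ m = E a m := by
    change DirectSum.toAddMonoid E (DirectSum.decompose M.deg m.1) = _
    rw [DirectSum.decompose_coe]
    exact DirectSum.toAddMonoid_of E a m
  refine ⟨{ φ with map_smul' := fun r => ?_ }, hφ⟩
  refine DFunLike.congr_fun (hom_ext (φ := φ.comp (DistribSMul.toAddMonoidHom _ r))
    (ψ := (DistribSMul.toAddMonoidHom L r).comp φ) fun a m hm => ?_)
  obtain ⟨t, ht⟩ := exists_sum_decompose (𝒜 := 𝒜) r
  change φ (r • m) = r • φ m
  rw [← ht t subset_rfl, Finset.sum_smul, Finset.sum_smul, map_sum]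
  refine Finset.sum_congr rfl fun c _ => ?_
  have hs := SetLike.coe_mem (DirectSum.decompose 𝒜 r c)
  exact (hφ _ ⟨_, M.smul_mem hs hm⟩).trans ((hE hs ⟨m, hm⟩).trans
    (congrArg _ (hφ a ⟨m, hm⟩).symm))

end GrMod

variable (𝒜 B) in
/-- At each point, every degree is the degree of a fraction of homogeneous elements that do not
vanish there. For the Cox ring this follows from the smoothness of the fan. -/
class HasHomogeneousUnits : Prop where
  exists_unit : ∀ (P : RelSpec 𝒜 B) (a : A), ∃ (b : A) (p q : S), p ∈ 𝒜 (b + a) ∧ q ∈ 𝒜 b ∧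
    p ∉ P.ideal ∧ q ∉ P.ideal

namespace RelSpec

variable [HasHomogeneousUnits 𝒜 B] (P : RelSpec 𝒜 B)

theorem exists_unit_mem_locDeg (a : A) : ∃ u : (P.Loc S)ˣ,
    (u : P.Loc S) ∈ (GrMod.self 𝒜).locDeg P a ∧
      ((u⁻¹ : (P.Loc S)ˣ) : P.Loc S) ∈ (GrMod.self 𝒜).locDeg P (-a) := by
  obtain ⟨b, p, q, hp, hq, hpP, hqP⟩ := HasHomogeneousUnits.exists_unit P a
  obtain ⟨u, hu⟩ := IsLocalization.map_units (P.Loc S) (⟨p, hpP⟩ : P.ideal.primeCompl)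
  obtain ⟨v, hv⟩ := IsLocalization.map_units (P.Loc S) (⟨q, hqP⟩ : P.ideal.primeCompl)
  refine ⟨u * v⁻¹, ⟨b, q, hq, hqP, p, hp, ?_⟩,
    ⟨b + a, p, hp, hpP, q, (add_neg_cancel_right b a).symm ▸ hq, ?_⟩⟩
  · rw [Algebra.smul_def, Units.val_mul, ← hv, mul_left_comm, Units.mul_inv, mul_one, hu]
    rfl
  · rw [Algebra.smul_def, mul_inv_rev, inv_inv, Units.val_mul, ← hu, mul_left_comm, Units.mul_inv,
      mul_one, hv]
    rfl

variable {P} {M N : GrMod 𝒜}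

omit [HasHomogeneousUnits 𝒜 B] in
theorem units_inv_smul_mem_locDeg {a : A} {u : (P.Loc S)ˣ}
    (hu : ((u⁻¹ : (P.Loc S)ˣ) : P.Loc S) ∈ (GrMod.self 𝒜).locDeg P (-a)) {m : M.carrier}
    (hm : m ∈ M.deg a) : u⁻¹ • P.toLoc _ m ∈ M.locDeg P 0 :=
  neg_add_cancel a ▸ GrMod.smul_mem_locDeg hu (GrMod.toLoc_mem_locDeg hm)

theorem linearMap_ext_of_locDeg_zero {φ ψ : P.Loc M.carrier →ₗ[P.Loc S] P.Loc N.carrier}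
    (h : ∀ z ∈ M.locDeg P 0, φ z = ψ z) : φ = ψ := by
  refine loc_hom_ext fun m => DFunLike.congr_fun (GrMod.hom_ext
    (φ := φ.toAddMonoidHom.comp (P.toLoc M.carrier).toAddMonoidHom)
    (ψ := ψ.toAddMonoidHom.comp (P.toLoc M.carrier).toAddMonoidHom) fun a m hm => ?_) m
  obtain ⟨u, -, hu⟩ := exists_unit_mem_locDeg P a
  change φ (P.toLoc _ m) = ψ (P.toLoc _ m)
  rw [← smul_inv_smul u (P.toLoc _ m), Units.smul_def u, φ.map_smul, ψ.map_smul,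
    h _ (units_inv_smul_mem_locDeg hu hm)]

variable (g : M.locDeg P 0 →+ P.Loc N.carrier)
  (hg : ∀ (c : P.Loc S) (z w : M.locDeg P 0), c ∈ (GrMod.self 𝒜).locDeg P 0 → w.1 = c • z.1 →
    g w = c • g z)
include hg

omit [HasHomogeneousUnits 𝒜 B] in
theorem exists_linearMap_eq_units_smul {u : A → (P.Loc S)ˣ}
    (hu : ∀ a, (u a : P.Loc S) ∈ (GrMod.self 𝒜).locDeg P a)
    (hu' : ∀ a, (((u a)⁻¹ : (P.Loc S)ˣ) : P.Loc S) ∈ (GrMod.self 𝒜).locDeg P (-a)) :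
    ∃ φ : M.carrier →ₗ[S] P.Loc N.carrier, ∀ a (m : M.deg a),
      φ m = u a • g ⟨(u a)⁻¹ • P.toLoc _ m.1, units_inv_smul_mem_locDeg (hu' a) m.2⟩ := by
  let E (a : A) : M.deg a →+ P.Loc N.carrier :=
    AddMonoidHom.mk' (fun m => u a • g ⟨_, units_inv_smul_mem_locDeg (hu' a) m.2⟩) fun m n => by
      rw [← smul_add, ← map_add]
      exact congrArg (u a • g ·) (Subtype.ext ((congrArg _ (map_add _ _ _)).trans (smul_add _ _ _)))
  refine GrMod.exists_linearMap_of_deg E fun {a c s} hs m => ?_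
  have ratio_mem : (↑(u (c + a))⁻¹ * algebraMap S (P.Loc S) s * u a : P.Loc S) ∈
      (GrMod.self 𝒜).locDeg P 0 := by
    have := GrMod.smul_mem_locDeg (GrMod.smul_mem_locDeg (hu' (c + a))
      (GrMod.toLoc_mem_locDeg (M := GrMod.self 𝒜) (P := P) (m := s) hs)) (hu a)
    rwa [add_assoc, neg_add_cancel] at this
  have g_smul : g ⟨_, units_inv_smul_mem_locDeg (hu' (c + a)) (M.smul_mem hs m.2)⟩ =
      _ • g ⟨_, units_inv_smul_mem_locDeg (hu' a) m.2⟩ := hg _ _ _ ratio_mem <| by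
    rw [mul_smul, mul_smul, algebraMap_smul, ← Units.smul_def, ← Units.smul_def, smul_inv_smul]
    exact congrArg ((u (c + a))⁻¹ • ·) (map_smul (P.toLoc _) s m.1)
  refine (congrArg (u (c + a) • ·) g_smul).trans ?_
  simp only [mul_smul, algebraMap_smul, ← Units.smul_def, smul_inv_smul]
  rfl

theorem exists_linearMap_of_locDeg_zero :
    ∃ φ : P.Loc M.carrier →ₗ[P.Loc S] P.Loc N.carrier, ∀ z : M.locDeg P 0, φ z = g z := by
  choose u hu hu' using exists_unit_mem_locDeg P
  obtain ⟨φ, hφ⟩ := exists_linearMap_eq_units_smul g hg hu hu'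
  have base := IsLocalizedModule.isBaseChange P.ideal.primeCompl (P.Loc S) (P.toLoc M.carrier)
  refine ⟨base.lift φ, fun z => ?_⟩
  obtain ⟨b, t, ht, htP, m, hm, hz⟩ := z.2
  have ratio_mem : (↑(u (b + 0))⁻¹ * algebraMap S (P.Loc S) t : P.Loc S) ∈
      (GrMod.self 𝒜).locDeg P 0 := by
    have := GrMod.smul_mem_locDeg (hu' (b + 0))
      (GrMod.toLoc_mem_locDeg (M := GrMod.self 𝒜) (P := P) (m := t) ht)
    rwa [add_zero, neg_add_cancel, ← add_zero b] at this
  have g_smul : g ⟨_, units_inv_smul_mem_locDeg (hu' (b + 0)) hm⟩ = _ • g z :=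
    hg _ z _ ratio_mem <| by rw [mul_smul, algebraMap_smul, ← Units.smul_def, hz]
  refine smul_left_cancel htP ?_
  rw [← LinearMap.map_smul_of_tower, hz, base.lift_eq, hφ _ ⟨m, hm⟩, g_smul, mul_smul,
    algebraMap_smul, ← Units.smul_def, smul_inv_smul]

end RelSpec

/-! ### Sections and stalks -/

/-- The open set of points at which a given element of the ring does not vanish. -/
def RelSpec.basicOpen (r : S) : Opens (RelSpec 𝒜 B) :=
  ⟨{P | r ∉ P.ideal}, (PrimeSpectrum.basicOpen r).2.preimage continuous_subtype_val⟩

theorem RelSpec.eventually_notMem {P : RelSpec 𝒜 B} {r : S} (hr : r ∉ P.ideal) :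
    ∀ᶠ Q : RelSpec 𝒜 B in nhds P, r ∉ Q.ideal :=
  (RelSpec.basicOpen r).2.eventually_mem hr

theorem RelSpec.notMem_of_mem_basicOpen {r : S} :
    ∀ P ∈ RelSpec.basicOpen (𝒜 := 𝒜) (B := B) r, r ∉ P.ideal :=
  fun _ h => h

theorem RelSpec.smul_eq_toLoc_congr {M : Type u} [AddCommGroup M] [Module S M]
    {P : RelSpec 𝒜 B} {z w : P.Loc M} {m n : M} {r s t : S} (hr : r ∉ P.ideal) (hs : s ∉ P.ideal)
    (ht : t ∉ P.ideal) (hz : r • z = P.toLoc M m) (hw : s • w = P.toLoc M n)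
    (h : t • s • m = t • r • n) : z = w := by
  have cross : P.toLoc M (s • m) = P.toLoc M (r • n) := toLoc_eq_iff.2 ⟨t, ht, h⟩
  rw [map_smul, map_smul, ← hz, ← hw, smul_comm s r] at cross
  exact smul_left_cancel hs (smul_left_cancel hr cross)

namespace ModSec

variable {M N : GrMod 𝒜} {U U' : Opens (RelSpec 𝒜 B)} {P : RelSpec 𝒜 B} {a : A} {m : M.carrier}
  {r : S}

/-- The section `m / r` of `M^~`. -/
def frac (hm : m ∈ M.deg a) (hr : r ∈ 𝒜 a) (hU : ∀ Q ∈ U, r ∉ Q.ideal) : ModSec M U :=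
  ⟨fun Q => LocalizedModule.mk m ⟨r, hU Q Q.2⟩, fun Q => ⟨U, Q.2, le_rfl, a, m, hm, r, hr,
    fun Q' => ⟨hU Q' Q'.2, rfl⟩⟩⟩

theorem smul_frac_apply (hm : m ∈ M.deg a) (hr : r ∈ 𝒜 a) (hU : ∀ Q ∈ U, r ∉ Q.ideal) (Q : U) :
    r • (frac hm hr hU).1 Q = Q.1.toLoc _ m :=
  RelSpec.smul_mk m (hU Q Q.2)

theorem exists_smul_eq (s : ModSec M U) (hP : P ∈ U) :
    ∃ (V : Opens (RelSpec 𝒜 B)) (_ : P ∈ V) (i : V ≤ U) (a : A), ∃ m ∈ M.deg a, ∃ r ∈ 𝒜 a,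
      ∀ Q : V, r ∉ Q.1.ideal ∧ r • s.1 ⟨Q, i Q.2⟩ = Q.1.toLoc _ m := by
  obtain ⟨V, hV, i, a, m, hm, r, hr, h⟩ := s.2 ⟨P, hP⟩
  refine ⟨V, hV, i, a, m, hm, r, hr, fun Q => ?_⟩
  obtain ⟨hrQ, hQ⟩ := h Q
  exact ⟨hrQ, (congrArg (r • ·) hQ).trans (RelSpec.smul_mk m hrQ)⟩

theorem apply_mem_locDeg (s : ModSec M U) (Q : U) : s.1 Q ∈ M.locDeg Q.1 0 := by
  obtain ⟨V, hV, _, a, m, hm, r, hr, h⟩ := s.exists_smul_eq Q.2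
  exact ⟨a, r, hr, (h ⟨Q, hV⟩).1, m, by rwa [add_zero], (h ⟨Q, hV⟩).2⟩

theorem exists_apply_eq {z : P.Loc M.carrier} (hz : z ∈ M.locDeg P 0) :
    ∃ (U : Opens (RelSpec 𝒜 B)) (hP : P ∈ U) (s : ModSec M U), s.1 ⟨P, hP⟩ = z := by
  obtain ⟨b, t, ht, htP, m, hm, hz⟩ := hz
  rw [add_zero] at hm
  exact ⟨_, htP, frac hm ht RelSpec.notMem_of_mem_basicOpen, RelSpec.smul_left_cancel htP
    ((smul_frac_apply hm ht _ ⟨P, htP⟩).trans hz.symm)⟩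

theorem exists_modRes_eq {hP : P ∈ U} {hP' : P ∈ U'} (s : ModSec M U) (s' : ModSec M U')
    (h : s.1 ⟨P, hP⟩ = s'.1 ⟨P, hP'⟩) :
    ∃ (V : Opens (RelSpec 𝒜 B)) (_ : P ∈ V) (i : V ≤ U) (i' : V ≤ U'),
      modRes M i s = modRes M i' s' := by
  obtain ⟨V, hV, i, _, m, _, r, _, hs⟩ := s.exists_smul_eq hP
  obtain ⟨V', hV', i', _, m', _, r', _, hs'⟩ := s'.exists_smul_eq hP'
  have cross : P.toLoc _ (r' • m) = P.toLoc _ (r • m') := by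
    rw [map_smul, map_smul, ← (hs ⟨P, hV⟩).2, ← (hs' ⟨P, hV'⟩).2, h, smul_comm]
  obtain ⟨t, ht, htm⟩ := RelSpec.toLoc_eq_iff.1 cross
  refine ⟨V ⊓ V' ⊓ RelSpec.basicOpen t, ⟨⟨hV, hV'⟩, ht⟩, (inf_le_left.trans inf_le_left).trans i,
    (inf_le_left.trans inf_le_right).trans i', Subtype.ext <| funext fun Q => ?_⟩
  obtain ⟨hrQ, hsQ⟩ := hs ⟨Q, Q.2.1.1⟩
  obtain ⟨hrQ', hsQ'⟩ := hs' ⟨Q, Q.2.1.2⟩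
  exact RelSpec.smul_eq_toLoc_congr hrQ hrQ' Q.2.2 hsQ hsQ' htm

end ModSec

section Morphisms

variable {M N L : GrMod 𝒜} (ε : tilde B M ⟶ tilde B N) {U U' V : Opens (RelSpec 𝒜 B)}

/-- The map on sections over `U` of a morphism `M^~ → N^~`. -/
def sectionMap (U : Opens (RelSpec 𝒜 B)) : ModSec M U →ₗ[RingSec U] ModSec N U :=
  (ε.val.app (op U)).hom

theorem tilde_hom_ext {ε ε' : tilde B M ⟶ tilde B N}
    (h : ∀ U s, sectionMap ε U s = sectionMap ε' U s) : ε = ε' :=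
  SheafOfModules.Hom.ext <| PresheafOfModules.Hom.ext <| funext fun U =>
    ModuleCat.hom_ext <| LinearMap.ext fun s => h U.unop s

theorem sectionMap_modRes (i : V ≤ U) (s : ModSec M U) :
    sectionMap ε V (modRes M i s) = modRes N i (sectionMap ε U s) :=
  PresheafOfModules.naturality_apply ε.val (homOfLE i).op s

theorem sectionMap_apply_congr {P : RelSpec 𝒜 B} {hP : P ∈ U} {hP' : P ∈ U'} {s : ModSec M U}
    {s' : ModSec M U'} (h : s.1 ⟨P, hP⟩ = s'.1 ⟨P, hP'⟩) :
    (sectionMap ε U s).1 ⟨P, hP⟩ = (sectionMap ε U' s').1 ⟨P, hP'⟩ := by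
  obtain ⟨V, hV, i, i', hss'⟩ := s.exists_modRes_eq s' h
  have := congrArg (sectionMap ε V) hss'
  rw [sectionMap_modRes, sectionMap_modRes] at this
  exact congrFun (congrArg Subtype.val this) ⟨P, hV⟩

variable (P : RelSpec 𝒜 B)

theorem exists_germMap : ∃ g : M.locDeg P 0 →+ P.Loc N.carrier,
    ∀ (U : Opens (RelSpec 𝒜 B)) (hP : P ∈ U) (s : ModSec M U),
      g ⟨s.1 ⟨P, hP⟩, s.apply_mem_locDeg ⟨P, hP⟩⟩ = (sectionMap ε U s).1 ⟨P, hP⟩ := by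
  choose U hP s hs using fun z : M.locDeg P 0 => ModSec.exists_apply_eq z.2
  refine ⟨AddMonoidHom.mk' (fun z => (sectionMap ε (U z) (s z)).1 ⟨P, hP z⟩) fun z w => ?_,
    fun V hV t => sectionMap_apply_congr ε (hs _)⟩
  let sum : ModSec M (U z ⊓ U w) := modRes M inf_le_left (s z) + modRes M inf_le_right (s w)
  have hsum : sum.1 ⟨P, hP z, hP w⟩ = (z + w : M.locDeg P 0) := congrArg₂ (· + ·) (hs z) (hs w)
  have hadd := sectionMap_apply_congr ε (U' := U z ⊓ U w) (hP' := ⟨hP z, hP w⟩) (s' := sum)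
    ((hs (z + w)).trans hsum.symm)
  rw [map_add, sectionMap_modRes, sectionMap_modRes] at hadd
  exact hadd

theorem exists_stalkMap [HasHomogeneousUnits 𝒜 B] :
    ∃ φ : P.Loc M.carrier →ₗ[P.Loc S] P.Loc N.carrier,
      ∀ (U : Opens (RelSpec 𝒜 B)) (hP : P ∈ U) (s : ModSec M U),
        φ (s.1 ⟨P, hP⟩) = (sectionMap ε U s).1 ⟨P, hP⟩ := by
  obtain ⟨g, hg⟩ := exists_germMap ε P
  obtain ⟨φ, hφ⟩ := RelSpec.exists_linearMap_of_locDeg_zero g fun c z w hc hw => by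
    obtain ⟨U, hU, r, rfl⟩ := ModSec.exists_apply_eq hc
    obtain ⟨V, hV, s, hs⟩ := ModSec.exists_apply_eq z.2
    let r' : RingSec (U ⊓ V) := ringRes inf_le_left ⟨r.1, r.2⟩
    let s' : ModSec M (U ⊓ V) := modRes M inf_le_right s
    have hgz : g z = (sectionMap ε _ s').1 ⟨P, hU, hV⟩ :=
      (congrArg g (Subtype.ext hs.symm)).trans (hg (U ⊓ V) ⟨hU, hV⟩ s')
    have hgw : g w = (sectionMap ε _ (r' • s')).1 ⟨P, hU, hV⟩ :=
      (congrArg g (Subtype.ext (hw.trans (congrArg _ hs.symm)))).trans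
        (hg (U ⊓ V) ⟨hU, hV⟩ (r' • s'))
    rw [hgz, hgw, map_smul]
    rfl
  exact ⟨φ, fun U hP s => (hφ _).trans (hg U hP s)⟩

variable [HasHomogeneousUnits 𝒜 B]

/-- The stalk at `P` of a morphism `M^~ → N^~`, extended from the homogeneous fractions of
degree `0` to all of `M_P`. -/
def stalkMap : P.Loc M.carrier →ₗ[P.Loc S] P.Loc N.carrier :=
  (exists_stalkMap ε P).choose

variable {P}

theorem stalkMap_apply_section {hP : P ∈ U} (s : ModSec M U) :
    stalkMap ε P (s.1 ⟨P, hP⟩) = (sectionMap ε U s).1 ⟨P, hP⟩ :=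
  (exists_stalkMap ε P).choose_spec U hP s

theorem stalkMap_eq_of_sections {φ : P.Loc M.carrier →ₗ[P.Loc S] P.Loc N.carrier}
    (h : ∀ (U : Opens (RelSpec 𝒜 B)) (hP : P ∈ U) (s : ModSec M U),
      (sectionMap ε U s).1 ⟨P, hP⟩ = φ (s.1 ⟨P, hP⟩)) : stalkMap ε P = φ := by
  refine RelSpec.linearMap_ext_of_locDeg_zero fun z hz => ?_
  obtain ⟨U, hP, s, rfl⟩ := ModSec.exists_apply_eq hz
  rw [stalkMap_apply_section, h]

theorem stalkMap_comp (ε' : tilde B N ⟶ tilde B L) :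
    stalkMap (ε ≫ ε') P = stalkMap ε' P ∘ₗ stalkMap ε P :=
  stalkMap_eq_of_sections _ fun U _ s => by
    rw [LinearMap.comp_apply, stalkMap_apply_section, stalkMap_apply_section]
    rfl

theorem stalkMap_zero : stalkMap (0 : tilde B M ⟶ tilde B N) P = 0 :=
  stalkMap_eq_of_sections _ fun _ _ _ => rfl

theorem stalkMap_tildeMap (f : M.Hom N) :
    stalkMap (tildeMap B f) P = LocalizedModule.map P.ideal.primeCompl f.toLin :=
  stalkMap_eq_of_sections _ fun _ _ _ => rfl

theorem stalkMap_tildeMap_toLoc (f : M.Hom N) (m : M.carrier) :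
    stalkMap (tildeMap B f) P (P.toLoc _ m) = P.toLoc _ (f.toLin m) := by
  rw [stalkMap_tildeMap]
  exact IsLocalizedModule.map_apply _ _ _ f.toLin m

theorem eventually_stalkMap_eq {M' : GrMod 𝒜} (ε' : tilde B M' ⟶ tilde B N) {a : A}
    {m : M.carrier} (hm : m ∈ M.deg a) {m' : M'.carrier} (hm' : m' ∈ M'.deg a)
    (h : stalkMap ε P (P.toLoc _ m) = stalkMap ε' P (P.toLoc _ m')) :
    ∀ᶠ Q in nhds P, stalkMap ε Q (Q.toLoc _ m) = stalkMap ε' Q (Q.toLoc _ m') := by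
  obtain ⟨b, p, q, hp, hq, hpP, hqP⟩ := HasHomogeneousUnits.exists_unit P a
  have smul_stalkMap {K : GrMod 𝒜} (ε : tilde B K ⟶ tilde B N) {x : K.carrier} (hx : x ∈ K.deg a)
      (Q : RelSpec.basicOpen p) : q • stalkMap ε Q.1 (Q.1.toLoc _ x) =
        p • (sectionMap ε _
          (ModSec.frac (K.smul_mem hq hx) hp RelSpec.notMem_of_mem_basicOpen)).1 Q := by
    rw [← LinearMap.map_smul_of_tower, ← map_smul (Q.1.toLoc _), ← stalkMap_apply_section,
      ← LinearMap.map_smul_of_tower]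
    exact congrArg _ (ModSec.smul_frac_apply _ hp _ Q).symm
  obtain ⟨V, hV, i, _, hV'⟩ := ModSec.exists_modRes_eq (P := P) (hP := hpP) (hP' := hpP)
    (sectionMap ε _ (ModSec.frac (M.smul_mem hq hm) hp RelSpec.notMem_of_mem_basicOpen))
    (sectionMap ε' _ (ModSec.frac (M'.smul_mem hq hm') hp RelSpec.notMem_of_mem_basicOpen))
    (RelSpec.smul_left_cancel hpP (by rw [← smul_stalkMap ε hm, ← smul_stalkMap ε' hm', h]))
  filter_upwards [V.2.eventually_mem hV, RelSpec.eventually_notMem hqP] with Q hQ hqQ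
  refine RelSpec.smul_left_cancel hqQ ?_
  rw [smul_stalkMap ε hm ⟨Q, i hQ⟩, smul_stalkMap ε' hm' ⟨Q, i hQ⟩]
  exact congrArg (p • ·) (congrFun (congrArg Subtype.val hV') ⟨Q, hQ⟩)

end Morphisms

/-! ### Exactness -/

section Exactness

variable {M N L : GrMod 𝒜} {P : RelSpec 𝒜 B} {a : A}

theorem tildeMap_surjective (f : M.Hom N) (hf : Function.Surjective f.toLin) :
    SheafSurjective (tildeMap B f) := by
  intro U s P hP
  obtain ⟨V, hV, i, a, n, hn, r, hr, hs⟩ := ModSec.exists_smul_eq (show ModSec N U from s) hP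
  obtain ⟨m, rfl⟩ := hf n
  refine ⟨V, hV, homOfLE i, ModSec.frac (M.proj_mem a m) hr fun Q hQ => (hs ⟨Q, hQ⟩).1,
    Subtype.ext <| funext fun Q => ?_⟩
  refine (LocalizedModule.map_mk _ f.toLin _ _).trans
    (RelSpec.smul_left_cancel (hs Q).1 ((RelSpec.smul_mk _ (hs Q).1).trans ?_))
  rw [← f.proj_comm, N.proj_same hn]
  exact (hs Q).2.symm

theorem tildeMap_exact (f : M.Hom N) (g : N.Hom L) (h : Function.Exact f.toLin g.toLin) :
    SheafExact (tildeMap B f) (tildeMap B g) := by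
  refine ⟨tilde_hom_ext fun U s => Subtype.ext <| funext fun Q => ?_, fun U s hs0 P hP => ?_⟩
  · change LocalizedModule.map _ g.toLin (LocalizedModule.map _ f.toLin (s.1 Q)) = 0
    induction s.1 Q using LocalizedModule.induction_on with
    | h m t =>
      rw [LocalizedModule.map_mk, LocalizedModule.map_mk, h.apply_apply_eq_zero,
        LocalizedModule.zero_mk]
  obtain ⟨V, hV, i, a, n, hn, r, hr, hs⟩ := ModSec.exists_smul_eq (show ModSec N U from s) hP
  have stalk_zero : LocalizedModule.map P.ideal.primeCompl g.toLin
      ((show ModSec N U from s).1 ⟨P, hP⟩) = 0 := congrFun (congrArg Subtype.val hs0) ⟨P, hP⟩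
  have numerator_zero : P.toLoc _ (g.toLin n) = P.toLoc _ 0 := by
    refine (IsLocalizedModule.map_apply P.ideal.primeCompl (P.toLoc N.carrier) (P.toLoc L.carrier)
      g.toLin n).symm.trans ?_
    rw [map_zero, ← (hs ⟨P, hV⟩).2]
    exact (LinearMap.map_smul_of_tower _ _ _).trans ((congrArg _ stalk_zero).trans (smul_zero r))
  obtain ⟨c, t, ht, htP, htn⟩ :=
    GrMod.exists_homogeneous_smul_eq (g.map_deg hn) (zero_mem _) numerator_zero
  rw [smul_zero, ← map_smul] at htn
  obtain ⟨m, hm⟩ := (h _).1 htn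
  have htr : ∀ Q ∈ V ⊓ RelSpec.basicOpen t, t * r ∉ Q.ideal := fun Q hQ =>
    RelSpec.mul_notMem hQ.2 (hs ⟨Q, hQ.1⟩).1
  refine ⟨V ⊓ RelSpec.basicOpen t, ⟨hV, htP⟩, homOfLE (inf_le_left.trans i),
    ModSec.frac (M.proj_mem (c + a) m) (SetLike.mul_mem_graded ht hr) htr,
    Subtype.ext <| funext fun Q => ?_⟩
  refine (LocalizedModule.map_mk _ f.toLin _ _).trans ?_
  refine RelSpec.smul_eq_toLoc_congr (htr Q Q.2) (hs ⟨Q, Q.2.1⟩).1 Q.1.one_notMem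
    (RelSpec.smul_mk _ (htr Q Q.2)) (hs ⟨Q, Q.2.1⟩).2 ?_
  rw [← f.proj_comm, hm, N.proj_same (N.smul_mem ht hn), smul_smul r t, mul_comm]

theorem GrMod.freeResolution_isVirtualResolution [IsNoetherianRing S] (M : GrMod 𝒜)
    (hM : Module.Finite S M.carrier) : IsVirtualResolution B (M.freeResolution hM) M :=
  ⟨tildeMap B (M.freeResolutionAug hM),
    tildeMap_surjective _ (M.freeResolutionAug_surjective hM),
    tildeMap_exact _ _ (M.freeResolutionAug_exact hM),
    fun i => tildeMap_exact _ _ (M.freeResolution_exact hM i)⟩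

variable [HasHomogeneousUnits 𝒜 B]

theorem stalkMap_mem_locDeg (ε : tilde B M ⟶ tilde B N) {z : P.Loc M.carrier}
    (hz : z ∈ M.locDeg P a) : stalkMap ε P z ∈ N.locDeg P a := by
  obtain ⟨u, hu, hu'⟩ := RelSpec.exists_unit_mem_locDeg P a
  have inv_mem : u⁻¹ • z ∈ M.locDeg P 0 := neg_add_cancel a ▸ GrMod.smul_mem_locDeg hu' hz
  obtain ⟨U, hU, s, hs⟩ := ModSec.exists_apply_eq inv_mem
  have degree_zero : stalkMap ε P (u⁻¹ • z) ∈ N.locDeg P 0 := by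
    rw [← hs, stalkMap_apply_section]
    exact (sectionMap ε U s).apply_mem_locDeg ⟨P, hU⟩
  have := GrMod.smul_mem_locDeg hu degree_zero
  rwa [add_zero, ← (stalkMap ε P).map_smul, ← Units.smul_def, smul_inv_smul] at this

theorem exists_mem_locDeg_of_degree_zero {φ : P.Loc M.carrier →ₗ[P.Loc S] P.Loc N.carrier}
    {ψ : P.Loc N.carrier →ₗ[P.Loc S] P.Loc L.carrier}
    (h : ∀ z ∈ N.locDeg P 0, ψ z = 0 → ∃ y ∈ M.locDeg P 0, φ y = z) {z : P.Loc N.carrier}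
    (hz : z ∈ N.locDeg P a) (h0 : ψ z = 0) : ∃ y ∈ M.locDeg P a, φ y = z := by
  obtain ⟨u, hu, hu'⟩ := RelSpec.exists_unit_mem_locDeg P a
  obtain ⟨y, hy, hyz⟩ := h (u⁻¹ • z) (neg_add_cancel a ▸ GrMod.smul_mem_locDeg hu' hz)
    ((ψ.map_smul _ z).trans (by rw [h0, smul_zero]))
  exact ⟨u • y, add_zero a ▸ GrMod.smul_mem_locDeg hu hy,
    (φ.map_smul _ y).trans ((congrArg _ hyz).trans (smul_inv_smul u z))⟩

theorem SheafSurjective.exists_mem_locDeg {ε : tilde B M ⟶ tilde B N} (hε : SheafSurjective ε)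
    {z : P.Loc N.carrier} (hz : z ∈ N.locDeg P a) : ∃ y ∈ M.locDeg P a, stalkMap ε P y = z := by
  refine exists_mem_locDeg_of_degree_zero (ψ := (0 : _ →ₗ[P.Loc S] P.Loc N.carrier))
    (fun z hz _ => ?_) hz rfl
  obtain ⟨U, hU, s, rfl⟩ := ModSec.exists_apply_eq hz
  obtain ⟨V, hV, i, t, ht⟩ := hε U s P hU
  exact ⟨_, ModSec.apply_mem_locDeg t ⟨P, hV⟩, (stalkMap_apply_section ε t).trans
    (congrFun (congrArg Subtype.val ht) ⟨P, hV⟩)⟩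

theorem SheafExact.exists_mem_locDeg {φ : tilde B M ⟶ tilde B N} {ψ : tilde B N ⟶ tilde B L}
    (h : SheafExact φ ψ) {z : P.Loc N.carrier} (hz : z ∈ N.locDeg P a)
    (h0 : stalkMap ψ P z = 0) : ∃ y ∈ M.locDeg P a, stalkMap φ P y = z := by
  refine exists_mem_locDeg_of_degree_zero (fun z hz h0 => ?_) hz h0
  obtain ⟨U, hU, s, rfl⟩ := ModSec.exists_apply_eq hz
  obtain ⟨V, hV, i, _, hres⟩ := (sectionMap ψ U s).exists_modRes_eq (hP' := hU) (0 : ModSec L U)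
    ((stalkMap_apply_section ψ s).symm.trans h0)
  obtain ⟨W, hW, j, t, ht⟩ := h.2 V (modRes N i s)
    ((sectionMap_modRes ψ i s).trans (hres.trans (map_zero _))) P hV
  exact ⟨_, ModSec.apply_mem_locDeg t ⟨P, hW⟩, (stalkMap_apply_section φ t).trans
    (congrFun (congrArg Subtype.val ht) ⟨P, hW⟩)⟩

theorem SheafExact.stalkMap_stalkMap {φ : tilde B M ⟶ tilde B N} {ψ : tilde B N ⟶ tilde B L}
    (h : SheafExact φ ψ) (z : P.Loc M.carrier) : stalkMap ψ P (stalkMap φ P z) = 0 := by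
  rw [← LinearMap.comp_apply, ← stalkMap_comp, h.1, stalkMap_zero, LinearMap.zero_apply]

theorem SheafSurjective.exists_stalkMap_toLoc_eq {ε : tilde B M ⟶ tilde B N}
    (hε : SheafSurjective ε) {z : P.Loc N.carrier} (hz : z ∈ N.locDeg P a) :
    ∃ c, ∃ t ∈ 𝒜 c, t ∉ P.ideal ∧ ∃ m ∈ M.deg (c + a), stalkMap ε P (P.toLoc _ m) = t • z := by
  obtain ⟨y, ⟨c, t, ht, htP, m, hm, hy⟩, rfl⟩ := hε.exists_mem_locDeg hz
  exact ⟨c, t, ht, htP, m, hm, hy ▸ LinearMap.map_smul_of_tower _ t y⟩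

theorem SheafExact.exists_toLin_eq_smul {f : M.Hom N} {ψ : tilde B N ⟶ tilde B L}
    (h : SheafExact (tildeMap B f) ψ) {n : N.carrier} (hn : n ∈ N.deg a)
    (h0 : stalkMap ψ P (P.toLoc _ n) = 0) :
    ∃ c, ∃ t ∈ 𝒜 c, t ∉ P.ideal ∧ ∃ m ∈ M.deg (c + a), f.toLin m = t • n := by
  obtain ⟨y, ⟨c, s, hs, hsP, m, hm, hy⟩, hyn⟩ :=
    h.exists_mem_locDeg (GrMod.toLoc_mem_locDeg hn) h0
  have stalk_eq : P.toLoc _ (f.toLin m) = P.toLoc _ (s • n) := by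
    rw [← stalkMap_tildeMap_toLoc, ← hy, LinearMap.map_smul_of_tower, hyn, map_smul]
  obtain ⟨e, t, ht, htP, htn⟩ :=
    GrMod.exists_homogeneous_smul_eq (f.map_deg hm) (N.smul_mem hs hn) stalk_eq
  exact ⟨e + c, t * s, SetLike.mul_mem_graded ht hs, RelSpec.mul_notMem htP hsP, t • m,
    (add_assoc e c a).symm ▸ M.smul_mem ht hm, by rw [map_smul, htn, mul_smul]⟩

end Exactness

/-! ### Chain maps up to denominators -/

/-- The linear map `φ` is homogeneous of degree `c`. -/
def HasDegree {M N : GrMod 𝒜} (c : A) (φ : M.carrier →ₗ[S] N.carrier) : Prop :=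
  ∀ (a : A) (m : M.carrier), m ∈ M.deg a → φ m ∈ N.deg (c + a)

namespace HasDegree

variable {M N L : GrMod 𝒜} {c c' : A} {φ ψ : M.carrier →ₗ[S] N.carrier}
  {χ : N.carrier →ₗ[S] L.carrier}

section

omit [GradedAlgebra 𝒜]

theorem zero : HasDegree c (0 : M.carrier →ₗ[S] N.carrier) := fun _ _ _ => zero_mem _

theorem sub (hφ : HasDegree c φ) (hψ : HasDegree c ψ) : HasDegree c (φ - ψ) :=
  fun a m hm => sub_mem (hφ a m hm) (hψ a m hm)

theorem smul {s : S} (hs : s ∈ 𝒜 c') (hφ : HasDegree c φ) : HasDegree (c' + c) (s • φ) :=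
  fun a m hm => (add_assoc c' c a).symm ▸ N.smul_mem hs (hφ a m hm)

theorem comp (hχ : HasDegree c' χ) (hφ : HasDegree c φ) : HasDegree (c' + c) (χ ∘ₗ φ) :=
  fun a m hm => (add_assoc c' c a).symm ▸ hχ _ _ (hφ a m hm)

theorem comp_hom (hχ : HasDegree c χ) (f : M.Hom N) : HasDegree c (χ ∘ₗ f.toLin) :=
  fun a _ hm => hχ a _ (f.map_deg hm)

end

theorem of_basis {n : ℕ} (b : Module.Basis (Fin n) S M.carrier) {d : Fin n → A}
    (hb : ∀ j, b j ∈ M.deg (d j)) (h : ∀ j, φ (b j) ∈ N.deg (c + d j)) : HasDegree c φ := by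
  intro a m hm
  have expansion : m = ∑ j, (DirectSum.decompose 𝒜 (b.repr m j) (a - d j) : S) • b j := by
    conv_lhs => rw [← M.proj_same hm, ← b.sum_repr m, map_sum]
    exact Finset.sum_congr rfl fun j _ => M.proj_smul _ (hb j) a
  rw [expansion, map_sum]
  refine sum_mem fun j _ => ?_
  rw [map_smul]
  have := N.smul_mem (SetLike.coe_mem (DirectSum.decompose 𝒜 (b.repr m j) (a - d j))) (h j)
  rwa [show a - d j + (c + d j) = c + a by abel] at this

end HasDegree

theorem GrMod.IsGrFree.exists_lift {P : RelSpec 𝒜 B} {G E : GrMod 𝒜} (hG : G.IsGrFree)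
    {L : Type u} [AddCommGroup L] [Module S L] (f : E.carrier →ₗ[S] L) (θ : G.carrier →ₗ[S] L)
    (c : A) (h : ∀ a, ∀ x ∈ G.deg a, ∃ c', ∃ t ∈ 𝒜 c', t ∉ P.ideal ∧
      ∃ y ∈ E.deg (c' + (c + a)), f y = t • θ x) :
    ∃ c', ∃ t ∈ 𝒜 c', t ∉ P.ideal ∧
      ∃ ψ : G.carrier →ₗ[S] E.carrier, HasDegree (c' + c) ψ ∧ f ∘ₗ ψ = t • θ := by
  classical
  obtain ⟨n, b, d, hb⟩ := hG
  choose c' t ht htP y hy hf using fun j => h (d j) (b j) (hb j)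
  refine ⟨∑ j, c' j, ∏ j, t j, SetLike.prod_mem_graded _ _ _ fun j _ => ht j,
    P.ideal.primeCompl.prod_mem fun j _ => htP j,
    b.constr S fun j => (∏ i ∈ Finset.univ.erase j, t i) • y j, ?_, ?_⟩
  · refine HasDegree.of_basis b hb fun j => ?_
    rw [Module.Basis.constr_basis]
    have := E.smul_mem (SetLike.prod_mem_graded 𝒜 c' t (F := Finset.univ.erase j)
      fun i _ => ht i) (hy j)
    rwa [← add_assoc, Finset.sum_erase_add _ _ (Finset.mem_univ j), ← add_assoc] at this
  · refine b.ext fun j => ?_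
    rw [LinearMap.comp_apply, Module.Basis.constr_basis, map_smul, hf, smul_smul,
      Finset.prod_erase_mul _ _ (Finset.mem_univ j), LinearMap.smul_apply]

/-- The morphism `ε` makes `0 ← M^~ ← F_0^~ ← F_1^~ ← ⋯` exact, so that `F` is a virtual
resolution of `M` by means of `ε`. -/
structure FreeComplex.IsAugmentation (F : FreeComplex 𝒜) {M : GrMod 𝒜}
    (ε : tilde B (F.X 0) ⟶ tilde B M) : Prop where
  surjective : SheafSurjective ε
  exact_zero : SheafExact (tildeMap B (F.d 0)) ε
  exact_succ : ∀ i, SheafExact (tildeMap B (F.d (i + 1))) (tildeMap B (F.d i))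

/-- A homogeneous map `G → F` that commutes with the differentials in degrees at most `n`,
together with a homogeneous ring element of the same degree. It stands for the quotient of the two,
a chain map of degree `0` at the points where the element does not vanish. -/
structure FractionalChainMap (n : ℕ) (G F : FreeComplex 𝒜) where
  shift : A
  denom : S
  denom_mem : denom ∈ 𝒜 shift
  map : ∀ j, (G.X j).carrier →ₗ[S] (F.X j).carrier
  hasDegree : ∀ j, HasDegree shift (map j)
  comm : ∀ j < n, (F.d j).toLin ∘ₗ map (j + 1) = map j ∘ₗ (G.d j).toLin

namespace FractionalChainMap

variable {n : ℕ} {F G H : FreeComplex 𝒜}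

/-- The identity chain map, with denominator `1`. -/
def id (n : ℕ) (F : FreeComplex 𝒜) : FractionalChainMap n F F where
  shift := 0
  denom := 1
  denom_mem := SetLike.one_mem_graded 𝒜
  map _ := LinearMap.id
  hasDegree _ a x hx := by rwa [zero_add]
  comm _ _ := rfl

/-- The composition of chain maps with denominators; the denominators multiply. -/
def comp (K : FractionalChainMap n G F) (L : FractionalChainMap n H G) :
    FractionalChainMap n H F where
  shift := K.shift + L.shift
  denom := K.denom * L.denom
  denom_mem := SetLike.mul_mem_graded K.denom_mem L.denom_mem
  map j := K.map j ∘ₗ L.map j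
  hasDegree j := (K.hasDegree j).comp (L.hasDegree j)
  comm j hj := by
    rw [← LinearMap.comp_assoc, K.comm j hj, LinearMap.comp_assoc, L.comm j hj,
      LinearMap.comp_assoc]

/-- The chain map concentrated in degree `0`, where it is `ψ / t`. -/
def single {ψ : (G.X 0).carrier →ₗ[S] (F.X 0).carrier} {c : A} {t : S} (ht : t ∈ 𝒜 c)
    (hψ : HasDegree c ψ) : FractionalChainMap 0 G F where
  shift := c
  denom := t
  denom_mem := ht
  map
    | 0 => ψ
    | _ + 1 => 0
  hasDegree
    | 0 => hψ
    | _ + 1 => HasDegree.zero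
  comm _ hj := absurd hj (Nat.not_lt_zero _)

/-- The extension by `ψ` in degree `n + 1` of a chain map in degrees at most `n`, brought to the
common denominator `t * L.denom`. -/
def extend (L : FractionalChainMap n G F) {ψ : (G.X (n + 1)).carrier →ₗ[S] (F.X (n + 1)).carrier}
    {c : A} {t : S} (ht : t ∈ 𝒜 c) (hψ : HasDegree (c + L.shift) ψ)
    (h : (F.d n).toLin ∘ₗ ψ = t • (L.map n ∘ₗ (G.d n).toLin)) : FractionalChainMap (n + 1) G F where
  shift := c + L.shift
  denom := t * L.denom
  denom_mem := SetLike.mul_mem_graded ht L.denom_mem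
  map := Function.update (fun j => t • L.map j) (n + 1) ψ
  hasDegree j := by
    rcases eq_or_ne j (n + 1) with rfl | hj
    · rwa [Function.update_self]
    · rw [Function.update_of_ne hj]
      exact (L.hasDegree j).smul ht
  comm j hj := by
    rw [Function.update_of_ne (by lia : j ≠ n + 1)]
    rcases eq_or_ne j n with rfl | hjn
    · rw [Function.update_self, h, LinearMap.smul_comp]
    · rw [Function.update_of_ne (by lia : j + 1 ≠ n + 1), LinearMap.comp_smul,
        L.comm j (by lia), LinearMap.smul_comp]

theorem extend_map_zero (L : FractionalChainMap n G F)
    {ψ : (G.X (n + 1)).carrier →ₗ[S] (F.X (n + 1)).carrier} {c : A} {t : S} (ht : t ∈ 𝒜 c)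
    (hψ : HasDegree (c + L.shift) ψ)
    (h : (F.d n).toLin ∘ₗ ψ = t • (L.map n ∘ₗ (G.d n).toLin)) :
    (L.extend ht hψ h).map 0 = t • L.map 0 :=
  Function.update_of_ne n.succ_ne_zero.symm ψ fun j => t • L.map j

variable [HasHomogeneousUnits 𝒜 B] {M : GrMod 𝒜}

/-- At the point `P`, the chain map with denominator is defined and compatible with the
augmentations `ε'` and `ε`. -/
def IsLift (L : FractionalChainMap n G F) (ε' : tilde B (G.X 0) ⟶ tilde B M)
    (ε : tilde B (F.X 0) ⟶ tilde B M) (P : RelSpec 𝒜 B) : Prop :=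
  L.denom ∉ P.ideal ∧
    ∀ x, stalkMap ε P (P.toLoc _ (L.map 0 x)) = L.denom • stalkMap ε' P (P.toLoc _ x)

theorem isLift_id (ε : tilde B (F.X 0) ⟶ tilde B M) (P : RelSpec 𝒜 B) :
    (id n F).IsLift ε ε P :=
  ⟨P.one_notMem, fun _ => (one_smul _ _).symm⟩

variable {ε : tilde B (F.X 0) ⟶ tilde B M} {ε' : tilde B (G.X 0) ⟶ tilde B M}
  {ε'' : tilde B (H.X 0) ⟶ tilde B M} {P : RelSpec 𝒜 B}

theorem IsLift.comp {K : FractionalChainMap n G F} {L : FractionalChainMap n H G}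
    (hK : K.IsLift ε' ε P) (hL : L.IsLift ε'' ε' P) : (K.comp L).IsLift ε'' ε P :=
  ⟨RelSpec.mul_notMem hK.1 hL.1, fun x =>
    (hK.2 (L.map 0 x)).trans (by rw [hL.2, ← mul_smul]; rfl)⟩

theorem IsLift.eventually {L : FractionalChainMap n G F} (hL : L.IsLift ε' ε P) :
    ∀ᶠ Q in nhds P, L.IsLift ε' ε Q := by
  obtain ⟨m, b, d, hb⟩ := G.free 0
  have on_basis (j) : ∀ᶠ Q in nhds P, stalkMap ε Q (Q.toLoc _ (L.map 0 (b j))) =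
      stalkMap ε' Q (Q.toLoc _ (L.denom • b j)) :=
    eventually_stalkMap_eq ε ε' (L.hasDegree 0 _ _ (hb j)) ((G.X 0).smul_mem L.denom_mem (hb j))
      (by rw [hL.2, map_smul, LinearMap.map_smul_of_tower])
  filter_upwards [Filter.eventually_all.2 on_basis, RelSpec.eventually_notMem hL.1] with Q hQ hLQ
  have : (stalkMap ε Q).restrictScalars S ∘ₗ Q.toLoc _ ∘ₗ L.map 0 =
      (stalkMap ε' Q).restrictScalars S ∘ₗ Q.toLoc _ ∘ₗ (L.denom • LinearMap.id) :=
    b.ext hQ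
  refine ⟨hLQ, fun x => (LinearMap.congr_fun this x).trans ?_⟩
  exact (congrArg _ (map_smul (Q.toLoc _) L.denom x)).trans (LinearMap.map_smul_of_tower _ _ _)

theorem IsLift.exists_extend (hε : F.IsAugmentation ε) (hε' : G.IsAugmentation ε')
    {L : FractionalChainMap n G F} (hL : L.IsLift ε' ε P) :
    ∃ L' : FractionalChainMap (n + 1) G F, L'.IsLift ε' ε P := by
  obtain ⟨c, t, ht, htP, ψ, hψ, h⟩ := (G.free (n + 1)).exists_lift (P := P) (F.d n).toLin
    (L.map n ∘ₗ (G.d n).toLin) L.shift fun a x hx => by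
      have hdeg := (L.hasDegree n).comp_hom (G.d n) a x hx
      cases n with
      | zero =>
        refine hε.exact_zero.exists_toLin_eq_smul hdeg ?_
        rw [LinearMap.comp_apply, hL.2, ← stalkMap_tildeMap_toLoc,
          hε'.exact_zero.stalkMap_stalkMap, smul_zero]
      | succ m =>
        refine (hε.exact_succ m).exists_toLin_eq_smul hdeg ?_
        have d_comp : (F.d m).toLin ∘ₗ L.map (m + 1) ∘ₗ (G.d (m + 1)).toLin = 0 := by
          rw [← LinearMap.comp_assoc, L.comm m m.lt_succ_self, LinearMap.comp_assoc, G.d_comp_d,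
            LinearMap.comp_zero]
        rw [stalkMap_tildeMap_toLoc]
        exact (congrArg _ (LinearMap.congr_fun d_comp x)).trans (map_zero _)
  refine ⟨L.extend ht hψ h, RelSpec.mul_notMem htP hL.1, fun x => ?_⟩
  rw [extend_map_zero, LinearMap.smul_apply, map_smul, LinearMap.map_smul_of_tower, hL.2,
    ← mul_smul]
  rfl

theorem exists_isLift (hε : F.IsAugmentation ε) (hε' : G.IsAugmentation ε') (P : RelSpec 𝒜 B) :
    ∀ n, ∃ L : FractionalChainMap n G F, L.IsLift ε' ε P
  | 0 => by
    obtain ⟨c, t, ht, htP, ψ, hψ, h⟩ := (G.free 0).exists_lift (P := P)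
      ((stalkMap ε P).restrictScalars S ∘ₗ P.toLoc _)
      ((stalkMap ε' P).restrictScalars S ∘ₗ P.toLoc _) 0 fun a x hx =>
        hε.surjective.exists_stalkMap_toLoc_eq
          (stalkMap_mem_locDeg ε' (GrMod.toLoc_mem_locDeg ((zero_add a).symm ▸ hx)))
    exact ⟨single ht (add_zero c ▸ hψ), htP, fun x => LinearMap.congr_fun h x⟩
  | n + 1 => by
    obtain ⟨L, hL⟩ := exists_isLift hε hε' P n
    exact hL.exists_extend hε hε'

end FractionalChainMap

/-! ### Homotopies up to denominators -/

/-- The map `ρ` on the `n`-th term of the complex factors over the differential to the term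
`n - 1`, which is `0` for `n = 0`. Here `ρ` need not be homogeneous. -/
def FreeComplex.IsCoboundary (G : FreeComplex 𝒜) {N : GrMod 𝒜} :
    ∀ n, ((G.X n).carrier →ₗ[S] N.carrier) → Prop
  | 0, ρ => ρ = 0
  | n + 1, ρ => ∃ σ : (G.X n).carrier →ₗ[S] N.carrier, ρ = σ ∘ₗ (G.d n).toLin

namespace FreeComplex.IsCoboundary

variable {G : FreeComplex 𝒜} {N N' : GrMod 𝒜} {n : ℕ} {ρ : (G.X n).carrier →ₗ[S] N.carrier}

theorem comp_d (h : G.IsCoboundary n ρ) : ρ ∘ₗ (G.d n).toLin = 0 := by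
  cases n with
  | zero => rw [show ρ = 0 from h, LinearMap.zero_comp]
  | succ n =>
    obtain ⟨σ, rfl⟩ := h
    rw [LinearMap.comp_assoc, G.d_comp_d, LinearMap.comp_zero]

theorem comp_left (α : N.carrier →ₗ[S] N'.carrier) (h : G.IsCoboundary n ρ) :
    G.IsCoboundary n (α ∘ₗ ρ) := by
  cases n with
  | zero => exact (congrArg (α ∘ₗ ·) h).trans (LinearMap.comp_zero α)
  | succ n =>
    obtain ⟨σ, rfl⟩ := h
    exact ⟨α ∘ₗ σ, rfl⟩

end FreeComplex.IsCoboundary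

theorem FreeComplex.IsAugmentation.exists_homotopy [HasHomogeneousUnits 𝒜 B]
    {F G : FreeComplex 𝒜} {M : GrMod 𝒜} {ε : tilde B (F.X 0) ⟶ tilde B M} (hε : F.IsAugmentation ε)
    {P : RelSpec 𝒜 B} {c : A} {φ : ∀ j, (G.X j).carrier →ₗ[S] (F.X j).carrier}
    (hφ : ∀ j, HasDegree c (φ j)) (h0 : ∀ x, stalkMap ε P (P.toLoc _ (φ 0 x)) = 0) : ∀ (n : ℕ)
    (_ : ∀ j < n, (F.d j).toLin ∘ₗ φ (j + 1) = φ j ∘ₗ (G.d j).toLin),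
    ∃ c', ∃ t ∈ 𝒜 c', t ∉ P.ideal ∧ ∃ h : (G.X n).carrier →ₗ[S] (F.X (n + 1)).carrier,
      HasDegree (c' + c) h ∧ G.IsCoboundary n (t • φ n - (F.d n).toLin ∘ₗ h)
  | 0, _ => by
    obtain ⟨c', t, ht, htP, h, hh, e⟩ := (G.free 0).exists_lift (F.d 0).toLin (φ 0) c
      fun a x hx => hε.exact_zero.exists_toLin_eq_smul (hφ 0 a x hx) (h0 x)
    exact ⟨c', t, ht, htP, h, hh, sub_eq_zero.2 e.symm⟩
  | n + 1, comm => by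
    obtain ⟨c', t, ht, htP, h, hh, coboundary⟩ :=
      hε.exists_homotopy hφ h0 n fun j hj => comm j (by lia)
    have cycle : (F.d n).toLin ∘ₗ (t • φ (n + 1) - h ∘ₗ (G.d n).toLin) = 0 := by
      have := coboundary.comp_d
      rwa [LinearMap.sub_comp, LinearMap.smul_comp, ← comm n n.lt_succ_self, LinearMap.comp_assoc,
        ← LinearMap.comp_smul, ← LinearMap.comp_sub] at this
    obtain ⟨c'', t', ht', htP', h', hh', e⟩ := (G.free (n + 1)).exists_lift (P := P)
      (F.d (n + 1)).toLin (t • φ (n + 1) - h ∘ₗ (G.d n).toLin) (c' + c) fun a x hx =>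
        (hε.exact_succ n).exists_toLin_eq_smul
          ((((hφ (n + 1)).smul ht).sub (hh.comp_hom (G.d n))) a x hx) (by
            rw [stalkMap_tildeMap_toLoc]
            exact (congrArg _ (LinearMap.congr_fun cycle x)).trans (map_zero _))
    refine ⟨c'' + c', t' * t, SetLike.mul_mem_graded ht' ht, RelSpec.mul_notMem htP' htP, h',
      (add_assoc c'' c' c).symm ▸ hh', t' • h, ?_⟩
    rw [e, smul_sub, smul_smul, LinearMap.smul_comp, sub_sub_cancel]

/-! ### Cohomology -/

namespace FreeComplex

variable {F : FreeComplex 𝒜} {N : GrMod 𝒜} {i : ℕ} {α β : (F.X i).carrier →ₗ[S] N.carrier}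

theorem mem_coboundaries_iff : α ∈ F.coboundaries N i ↔ F.IsCoboundary i α := by
  cases i with
  | zero => exact Submodule.mem_bot S (M := ((F.X 0).homGr N (F.free 0)).carrier)
  | succ i => exact ⟨fun ⟨σ, h⟩ => ⟨σ, h.symm⟩, fun ⟨σ, h⟩ => ⟨σ, h.symm⟩⟩

variable (F) in
/-- The cohomology class of a cocycle `α`. -/
def cohClass (α : (F.X i).carrier →ₗ[S] N.carrier) (hα : α ∘ₗ (F.d i).toLin = 0) :
    (F.homCohomology N i).carrier :=
  Submodule.Quotient.mk ⟨α, hα⟩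

theorem exists_cohClass_eq (x : (F.homCohomology N i).carrier) : ∃ α hα, F.cohClass α hα = x := by
  obtain ⟨z, rfl⟩ := Submodule.Quotient.mk_surjective _ x
  exact ⟨z.1, z.2, rfl⟩

theorem mem_deg_homCohomology_iff {a : A} {x : (F.homCohomology N i).carrier} :
    x ∈ (F.homCohomology N i).deg a ↔ ∃ α hα, HasDegree a α ∧ F.cohClass α hα = x :=
  ⟨fun ⟨z, hz, h⟩ => ⟨z.1, z.2, hz, h⟩, fun ⟨α, hα, hdeg, h⟩ => ⟨⟨α, hα⟩, hdeg, h⟩⟩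

theorem smul_cohClass (s : S) (hα : α ∘ₗ (F.d i).toLin = 0) :
    s • F.cohClass α hα = F.cohClass (s • α) (by rw [LinearMap.smul_comp, hα, smul_zero]) :=
  rfl

theorem cohClass_eq_iff {hα : α ∘ₗ (F.d i).toLin = 0} {hβ : β ∘ₗ (F.d i).toLin = 0} :
    F.cohClass α hα = F.cohClass β hβ ↔ F.IsCoboundary i (α - β) :=
  (Submodule.Quotient.eq _).trans mem_coboundaries_iff

end FreeComplex

namespace FractionalChainMap

variable {n : ℕ} {F G H : FreeComplex 𝒜} (K : FractionalChainMap n G F)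
  (L : FractionalChainMap n H G) {N : GrMod 𝒜} {i : ℕ} (hi : i < n)
  {α : (F.X i).carrier →ₗ[S] N.carrier}

include hi in
theorem comp_map_comp_d (hα : α ∘ₗ (F.d i).toLin = 0) :
    (α ∘ₗ K.map i) ∘ₗ (G.d i).toLin = 0 := by
  rw [LinearMap.comp_assoc, ← K.comm i hi, ← LinearMap.comp_assoc, hα, LinearMap.zero_comp]

include hi in
theorem isCoboundary_comp_map (hα : F.IsCoboundary i α) : G.IsCoboundary i (α ∘ₗ K.map i) := by
  cases i with
  | zero => exact (congrArg (· ∘ₗ K.map 0) hα).trans (LinearMap.zero_comp _)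
  | succ i =>
    obtain ⟨σ, rfl⟩ := hα
    exact ⟨σ ∘ₗ K.map i, by rw [LinearMap.comp_assoc, K.comm i (by lia), LinearMap.comp_assoc]⟩

variable (N)

/-- The map on the cohomology of `Hom_S(-, N)` induced by the numerators of a chain map with
denominator; it ignores the denominator. -/
def pullback : (F.homCohomology N i).carrier →ₗ[S] (G.homCohomology N i).carrier :=
  Submodule.mapQ _ _ ((LinearMap.lcomp S N.carrier (K.map i)).restrict
    (p := LinearMap.ker (F.coboundary N i).toLin) (q := LinearMap.ker (G.coboundary N i).toLin)
    fun _ hα => K.comp_map_comp_d hi hα) fun _ hα => FreeComplex.mem_coboundaries_iff.2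
      (K.isCoboundary_comp_map hi (FreeComplex.mem_coboundaries_iff.1 hα))

theorem pullback_cohClass (hα : α ∘ₗ (F.d i).toLin = 0) :
    K.pullback N hi (F.cohClass α hα) = G.cohClass (α ∘ₗ K.map i) (K.comp_map_comp_d hi hα) :=
  rfl

theorem hasDegree_pullback :
    HasDegree (M := F.homCohomology N i) (N := G.homCohomology N i) K.shift
      (K.pullback N hi) := by
  intro a x hx
  obtain ⟨α, hα, hdeg, rfl⟩ := FreeComplex.mem_deg_homCohomology_iff.1 hx
  exact FreeComplex.mem_deg_homCohomology_iff.2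
    ⟨α ∘ₗ K.map i, K.comp_map_comp_d hi hα, add_comm a K.shift ▸ hdeg.comp (K.hasDegree i), rfl⟩

theorem pullback_id : (id n F).pullback N hi = LinearMap.id := by
  ext x
  obtain ⟨α, hα, rfl⟩ := FreeComplex.exists_cohClass_eq x
  rfl

theorem pullback_comp : (K.comp L).pullback N hi = L.pullback N hi ∘ₗ K.pullback N hi := by
  ext x
  obtain ⟨α, hα, rfl⟩ := FreeComplex.exists_cohClass_eq x
  rfl

variable [HasHomogeneousUnits 𝒜 B] {M : GrMod 𝒜} {ε : tilde B (F.X 0) ⟶ tilde B M}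
  {ε' : tilde B (G.X 0) ⟶ tilde B M} {P : RelSpec 𝒜 B}

theorem IsLift.exists_smul_sub_comp_eq (hε : F.IsAugmentation ε) {L L' : FractionalChainMap n G F}
    (hL : L.IsLift ε' ε P) (hL' : L'.IsLift ε' ε P) {i : ℕ} (hi : i < n) :
    ∃ t ∉ P.ideal, ∃ h : (G.X i).carrier →ₗ[S] (F.X (i + 1)).carrier,
      G.IsCoboundary i (t • (L'.denom • L.map i - L.denom • L'.map i) - (F.d i).toLin ∘ₗ h) := by
  obtain ⟨_, t, _, ht, h, _, coboundary⟩ := hε.exists_homotopy (P := P)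
    (c := L'.shift + L.shift) (φ := fun j => L'.denom • L.map j - L.denom • L'.map j)
    (fun j => ((L.hasDegree j).smul L'.denom_mem).sub
      (add_comm L.shift L'.shift ▸ (L'.hasDegree j).smul L.denom_mem))
    (fun x => by
      simp only [LinearMap.sub_apply, LinearMap.smul_apply, map_sub, map_smul]
      rw [LinearMap.map_smul_of_tower, LinearMap.map_smul_of_tower, hL.2, hL'.2, smul_comm,
        sub_self]) i
    fun j hj => by
      rw [LinearMap.comp_sub, LinearMap.comp_smul, LinearMap.comp_smul, L.comm j (by lia),
        L'.comm j (by lia), LinearMap.sub_comp, LinearMap.smul_comp, LinearMap.smul_comp]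
  exact ⟨t, ht, h, coboundary⟩

theorem IsLift.fracMap_pullback_eq (hε : F.IsAugmentation ε) {L L' : FractionalChainMap n G F}
    (hL : L.IsLift ε' ε P) (hL' : L'.IsLift ε' ε P) :
    P.fracMap (L.pullback N hi) hL.1 = P.fracMap (L'.pullback N hi) hL'.1 := by
  obtain ⟨t, ht, h, coboundary⟩ := hL.exists_smul_sub_comp_eq hε hL' hi
  refine (RelSpec.fracMap_eq_iff hL.1 hL'.1).2 fun x => RelSpec.toLoc_eq_iff.2 ⟨t, ht, ?_⟩
  obtain ⟨α, hα, rfl⟩ := FreeComplex.exists_cohClass_eq x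
  simp only [pullback_cohClass, FreeComplex.smul_cohClass]
  rw [FreeComplex.cohClass_eq_iff]
  have := coboundary.comp_left α
  rwa [LinearMap.comp_sub, ← LinearMap.comp_assoc, hα, LinearMap.zero_comp, sub_zero,
    LinearMap.comp_smul, LinearMap.comp_sub, LinearMap.comp_smul, LinearMap.comp_smul,
    smul_sub] at this

end FractionalChainMap

/-! ### Comparison of the cohomology sheaves -/

/-- A family of maps between the stalks of `M^~` and `N^~` which near each point is given by a
single homogeneous fraction. Such a family glues to a morphism of sheaves. -/
structure StalkFamily (B : Ideal S) (M N : GrMod 𝒜) where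
  map : ∀ P : RelSpec 𝒜 B, P.Loc M.carrier →ₗ[P.Loc S] P.Loc N.carrier
  exists_fracMap : ∀ P : RelSpec 𝒜 B, ∃ c, ∃ t ∈ 𝒜 c, ∃ f, HasDegree (M := M) (N := N) c f ∧
    ∀ᶠ Q in nhds P, ∃ ht : t ∉ Q.ideal, map Q = Q.fracMap f ht

namespace StalkFamily

variable {M N : GrMod 𝒜} {U : Opens (RelSpec 𝒜 B)}

theorem isLocHomFraction (Φ : StalkFamily B M N) (s : ModSec M U) :
    IsLocHomFraction N.deg fun Q : U => Φ.map Q.1 (s.1 Q) := by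
  intro P
  obtain ⟨V, hV, i, a, m, hm, r, hr, hs⟩ := s.exists_smul_eq P.2
  obtain ⟨c, t, ht, f, hf, h⟩ := Φ.exists_fracMap P
  obtain ⟨W, hW, hW_open, hPW⟩ := eventually_nhds_iff.1 h
  refine ⟨V ⊓ ⟨W, hW_open⟩, ⟨hV, hPW⟩, inf_le_left.trans i, c + a, f m, hf a m hm, t * r,
    SetLike.mul_mem_graded ht hr, fun Q => ?_⟩
  obtain ⟨hrQ, hsQ⟩ := hs ⟨Q, Q.2.1⟩
  obtain ⟨htQ, hΦ⟩ := hW Q Q.2.2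
  have htrQ : t * r ∉ Q.1.ideal := RelSpec.mul_notMem htQ hrQ
  refine ⟨htrQ, RelSpec.smul_left_cancel htrQ (Eq.trans ?_ (RelSpec.smul_mk (f m) htrQ).symm)⟩
  rw [mul_smul, ← LinearMap.map_smul_of_tower, hsQ, hΦ, RelSpec.smul_fracMap_toLoc]

/-- The map on sections over `U` given by a family of maps between stalks. -/
def mapSections (Φ : StalkFamily B M N) (U : Opens (RelSpec 𝒜 B)) :
    ModSec M U →ₗ[RingSec U] ModSec N U where
  toFun s := ⟨fun Q => Φ.map Q.1 (s.1 Q), Φ.isLocHomFraction s⟩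
  map_add' _ _ := Subtype.ext <| funext fun Q => (Φ.map Q.1).map_add _ _
  map_smul' _ _ := Subtype.ext <| funext fun Q => (Φ.map Q.1).map_smul _ _

/-- The morphism of sheaves glued from a family of maps between stalks. -/
def toHom (Φ : StalkFamily B M N) : tilde B M ⟶ tilde B N where
  val := PresheafOfModules.homMk
    { app := fun U => AddCommGrpCat.ofHom (Φ.mapSections U.unop).toAddMonoidHom
      naturality := fun _ _ _ => rfl } fun U => (Φ.mapSections U.unop).map_smul

/-- The isomorphism of sheaves glued from inverse families of maps between stalks. -/
def toIso (Φ : StalkFamily B M N) (Ψ : StalkFamily B N M)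
    (h : ∀ P, Ψ.map P ∘ₗ Φ.map P = LinearMap.id) (h' : ∀ P, Φ.map P ∘ₗ Ψ.map P = LinearMap.id) :
    tilde B M ≅ tilde B N where
  hom := Φ.toHom
  inv := Ψ.toHom
  hom_inv_id := tilde_hom_ext fun _ s => Subtype.ext <| funext fun Q =>
    LinearMap.congr_fun (h Q) (s.1 Q)
  inv_hom_id := tilde_hom_ext fun _ s => Subtype.ext <| funext fun Q =>
    LinearMap.congr_fun (h' Q) (s.1 Q)

end StalkFamily

namespace FreeComplex.IsAugmentation

variable [HasHomogeneousUnits 𝒜 B] {F G : FreeComplex 𝒜} {M : GrMod 𝒜}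
  {ε : tilde B (F.X 0) ⟶ tilde B M} {ε' : tilde B (G.X 0) ⟶ tilde B M}
  (hε : F.IsAugmentation ε) (hε' : G.IsAugmentation ε') (N : GrMod 𝒜) (i : ℕ) (P : RelSpec 𝒜 B)

/-- The map induced on the stalks at `P` of the cohomology sheaves by a lift of the identity of `M`
to the two resolutions; by `comparison_eq`, all lifts induce the same map. -/
def comparison :
    P.Loc (F.homCohomology N i).carrier →ₗ[P.Loc S] P.Loc (G.homCohomology N i).carrier :=
  P.fracMap ((FractionalChainMap.exists_isLift hε hε' P (i + 1)).choose.pullback N i.lt_succ_self)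
    (FractionalChainMap.exists_isLift hε hε' P (i + 1)).choose_spec.1

variable {P}

theorem comparison_eq {L : FractionalChainMap (i + 1) G F} (hL : L.IsLift ε' ε P) :
    hε.comparison hε' N i P = P.fracMap (L.pullback N i.lt_succ_self) hL.1 :=
  (FractionalChainMap.exists_isLift hε hε' P (i + 1)).choose_spec.fracMap_pullback_eq N
    i.lt_succ_self hε hL

theorem comparison_self : hε.comparison hε N i P = LinearMap.id := by
  rw [hε.comparison_eq hε N i (FractionalChainMap.isLift_id ε P)]
  simp only [FractionalChainMap.pullback_id]
  exact RelSpec.fracMap_id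

variable {H : FreeComplex 𝒜} {ε'' : tilde B (H.X 0) ⟶ tilde B M} (hε'' : H.IsAugmentation ε'')

theorem comparison_comp_comparison :
    hε'.comparison hε'' N i P ∘ₗ hε.comparison hε' N i P = hε.comparison hε'' N i P := by
  obtain ⟨K, hK⟩ := FractionalChainMap.exists_isLift hε hε' P (i + 1)
  obtain ⟨L, hL⟩ := FractionalChainMap.exists_isLift hε' hε'' P (i + 1)
  rw [hε.comparison_eq hε' N i hK, hε'.comparison_eq hε'' N i hL,
    hε.comparison_eq hε'' N i (hK.comp hL), RelSpec.fracMap_comp]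
  simp only [FractionalChainMap.pullback_comp]
  rfl

/-- The comparison maps at all points. -/
def comparisonFamily : StalkFamily B (F.homCohomology N i) (G.homCohomology N i) where
  map := hε.comparison hε' N i
  exists_fracMap P := by
    obtain ⟨L, hL⟩ := FractionalChainMap.exists_isLift hε hε' P (i + 1)
    refine ⟨L.shift, L.denom, L.denom_mem, L.pullback N i.lt_succ_self,
      L.hasDegree_pullback N i.lt_succ_self, ?_⟩
    filter_upwards [hL.eventually] with Q hQ using ⟨hQ.1, hε.comparison_eq hε' N i hQ⟩

/-- The isomorphism between the cohomology sheaves of two virtual resolutions. -/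
def homCohomologyIso : tilde B (F.homCohomology N i) ≅ tilde B (G.homCohomology N i) :=
  (hε.comparisonFamily hε' N i).toIso (hε'.comparisonFamily hε N i)
    (fun _ => (hε.comparison_comp_comparison hε' N i hε).trans (hε.comparison_self N i))
    fun _ => (hε'.comparison_comp_comparison hε N i hε').trans (hε'.comparison_self N i)

end FreeComplex.IsAugmentation

theorem IsVirtualResolution.nonempty_iso [HasHomogeneousUnits 𝒜 B] {F G : FreeComplex 𝒜}
    {M : GrMod 𝒜} (hF : IsVirtualResolution B F M) (hG : IsVirtualResolution B G M) (N : GrMod 𝒜)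
    (i : ℕ) : Nonempty (tilde B (F.homCohomology N i) ≅ tilde B (G.homCohomology N i)) := by
  obtain ⟨ε, hε⟩ := hF
  obtain ⟨ε', hε'⟩ := hG
  exact ⟨FreeComplex.IsAugmentation.homCohomologyIso ⟨hε.1, hε.2.1, hε.2.2⟩
    ⟨hε'.1, hε'.2.1, hε'.2.2⟩ N i⟩

theorem isZero_tilde (M : GrMod 𝒜) [Subsingleton M.carrier] : Limits.IsZero (tilde B M) :=
  (Limits.IsZero.iff_id_eq_zero _).2 <| tilde_hom_ext fun _ _ => Subtype.ext <| funext fun Q =>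
    Subsingleton.elim (α := Q.1.Loc M.carrier) _ _

theorem FreeComplex.LengthLE.subsingleton_homCohomology {F : FreeComplex 𝒜} {l : ℕ}
    (hF : F.LengthLE l) (N : GrMod 𝒜) {i : ℕ} (hi : l < i) :
    Subsingleton (F.homCohomology N i).carrier := by
  have := hF i hi
  refine subsingleton_of_forall_eq (F.cohClass 0 (LinearMap.zero_comp _)) fun x => ?_
  obtain ⟨α, hα, rfl⟩ := FreeComplex.exists_cohClass_eq x
  simp only [Subsingleton.elim α 0]

/-! ### The Cox ring of a smooth toric variety -/

namespace SmoothProjectiveFan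

variable {n : ℕ} {ι : Type} [Fintype ι] [DecidableEq ι] (X : SmoothProjectiveFan n ι)
  {σ : Finset ι}

theorem exists_dual_apply_ray_eq (hσ : σ ∈ X.maxCones) (D : ι → ℤ) :
    ∃ m : Module.Dual ℤ (Fin n → ℤ), ∀ i ∈ σ, m (X.ray i) = D i := by
  let b := Module.Basis.mk (X.linearIndependent σ hσ) (X.span_eq_top σ hσ).ge
  refine ⟨b.constr ℤ fun i : σ => D i, fun i hi => ?_⟩
  have := b.constr_basis ℤ (fun i : σ => D i) ⟨i, hi⟩
  rwa [Module.Basis.mk_apply] at this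

theorem exists_mk_eq_of_mem_maxCones (hσ : σ ∈ X.maxCones) (a : X.Pic) :
    ∃ D : ι → ℤ, (∀ i ∈ σ, D i = 0) ∧ Submodule.Quotient.mk D = a := by
  obtain ⟨D, rfl⟩ := Submodule.Quotient.mk_surjective _ a
  obtain ⟨m, hm⟩ := X.exists_dual_apply_ray_eq hσ D
  refine ⟨D - X.divMap m, fun i hi => sub_eq_zero.2 (hm i hi).symm, ?_⟩
  exact (Submodule.Quotient.eq _).2 ⟨-m, by rw [map_neg, sub_sub_cancel_left]⟩

theorem mk_eq_sum_rayClass (D : ι → ℤ) :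
    (Submodule.Quotient.mk D : X.Pic) = ∑ i, D i • X.rayClass i := by
  conv_lhs => rw [pi_eq_sum_univ' D, ← Submodule.mkQ_apply, map_sum]
  simp only [map_zsmul]
  rfl

theorem sum_toNat_smul_rayClass (D : ι → ℤ) :
    ∑ i, (D i).toNat • X.rayClass i =
      ∑ i, (-D i).toNat • X.rayClass i + Submodule.Quotient.mk D := by
  rw [mk_eq_sum_rayClass, ← Finset.sum_add_distrib]
  refine Finset.sum_congr rfl fun i _ => ?_
  rw [← natCast_zsmul, ← natCast_zsmul, ← add_smul, show ((D i).toNat : ℤ) = (-D i).toNat + D i by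
    lia]

variable (k : Type u) [Field k]

theorem prod_pow_mem_coxGrading (e : ι → ℕ) :
    ∏ i, (MvPolynomial.X i : MvPolynomial ι k) ^ e i ∈ X.coxGrading k (∑ i, e i • X.rayClass i) :=
  SetLike.prod_pow_mem_graded (X.coxGrading k) X.rayClass _ e fun i _ =>
    MvPolynomial.isWeightedHomogeneous_X k X.rayClass i

variable {k} {X} (P : RelSpec (X.coxGrading k) (X.irrelevantIdeal k))

theorem exists_maxCone_X_notMem : ∃ σ ∈ X.maxCones, ∀ i ∉ σ, MvPolynomial.X i ∉ P.ideal := by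
  by_contra! h
  refine P.2.2 (Ideal.span_le.2 ?_)
  rintro _ ⟨σ, hσ, rfl⟩
  obtain ⟨i, hi, hiP⟩ := h σ hσ
  exact Ideal.mem_of_dvd _ (Finset.dvd_prod_of_mem _ (Finset.mem_compl.2 hi)) hiP

variable {P}

theorem prod_pow_notMem (hP : ∀ i ∉ σ, MvPolynomial.X i ∉ P.ideal) {e : ι → ℕ}
    (he : ∀ i ∈ σ, e i = 0) : ∏ i, MvPolynomial.X i ^ e i ∉ P.ideal := by
  refine P.ideal.primeCompl.prod_mem fun i _ => ?_
  by_cases hi : i ∈ σ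
  · rw [he i hi, pow_zero]
    exact one_mem _
  · exact pow_mem (hP i hi : MvPolynomial.X i ∈ P.ideal.primeCompl) _

-- The unit of degree `[D]` is the Laurent monomial `x^D`, where `D` avoids the rays of the cone.
instance hasHomogeneousUnits : HasHomogeneousUnits (X.coxGrading k) (X.irrelevantIdeal k) where
  exists_unit P a := by
    obtain ⟨σ, hσ, hP⟩ := exists_maxCone_X_notMem P
    obtain ⟨D, hD, rfl⟩ := X.exists_mk_eq_of_mem_maxCones hσ a
    exact ⟨∑ i, (-D i).toNat • X.rayClass i, ∏ i, MvPolynomial.X i ^ (D i).toNat,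
      ∏ i, MvPolynomial.X i ^ (-D i).toNat,
      X.sum_toNat_smul_rayClass D ▸ X.prod_pow_mem_coxGrading k fun i => (D i).toNat,
      X.prod_pow_mem_coxGrading k _, prod_pow_notMem hP fun i hi => by rw [hD i hi, Int.toNat_zero],
      prod_pow_notMem hP fun i hi => by rw [hD i hi, neg_zero, Int.toNat_zero]⟩

end SmoothProjectiveFan

end

theorem mainTheorem5_general {A : Type} [AddCommGroup A] [DecidableEq A] {k S : Type u} [CommRing k]
    [CommRing S] [IsNoetherianRing S] [Algebra k S] {𝒜 : A → Submodule k S} [GradedAlgebra 𝒜]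
    {B : Ideal S} [HasHomogeneousUnits 𝒜 B] (M : GrMod 𝒜) [Module.Finite S M.carrier] :
    (∀ F : FreeComplex 𝒜, IsVirtualResolution B F M → ∀ (N : GrMod 𝒜) (i : ℕ),
      Nonempty (tilde B (M.gradedExt N i) ≅ tilde B (F.homCohomology N i))) ∧
    ∀ l : ℕ, (∃ F : FreeComplex 𝒜, IsVirtualResolution B F M ∧ F.LengthLE l) →
      ∀ (N : GrMod 𝒜) (i : ℕ), l < i → Limits.IsZero (tilde B (M.gradedExt N i)) := by
  have ext_iso (F : FreeComplex 𝒜) (hF : IsVirtualResolution B F M) (N : GrMod 𝒜) (i : ℕ) :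
      Nonempty (tilde B (M.gradedExt N i) ≅ tilde B (F.homCohomology N i)) :=
    (M.freeResolution_isVirtualResolution inferInstance).nonempty_iso hF N i
  refine ⟨ext_iso, ?_⟩
  rintro l ⟨F, hF, hl⟩ N i hi
  have := hl.subsingleton_homCohomology N hi
  exact (isZero_tilde (F.homCohomology N i)).of_iso (ext_iso F hF N i).some

theorem mainTheorem5 {k : Type u} [Field k] [IsAlgClosed k] {n : ℕ} {ι : Type} [Fintype ι]
    [DecidableEq ι] (X : SmoothProjectiveFan n ι) (M : X.CoxModule k)
    [Module.Finite (MvPolynomial ι k) M.carrier] :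
    (∀ F : FreeComplex (X.coxGrading k), IsVirtualResolution (X.irrelevantIdeal k) F M →
      ∀ (N : X.CoxModule k) [Module.Finite (MvPolynomial ι k) N.carrier] (i : ℕ),
        Nonempty (X.sheaf (M.gradedExt N i) ≅ X.sheaf (F.homCohomology N i))) ∧
    (∀ l : ℕ, (∃ F : FreeComplex (X.coxGrading k),
        IsVirtualResolution (X.irrelevantIdeal k) F M ∧ F.LengthLE l) →
      ∀ (N : X.CoxModule k) [Module.Finite (MvPolynomial ι k) N.carrier] (i : ℕ), l < i →
        Limits.IsZero (X.sheaf (M.gradedExt N i))) := by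
  have h := mainTheorem5_general (B := X.irrelevantIdeal k) M
  exact ⟨fun F hF N _ i => h.1 F hF N i, fun l hl N _ i hi => h.2 l hl N i hi⟩
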